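/- **Termination property of the APVA protocol.** *Setting.* Let $n\ge 3t+1$ and consider $n$ nodes, indexed by $[1:n]$, in an asynchronous network: every message between honest nodes eventually arrives, after an arbitrary delay. A set $\mathcal F$ of at most $t$ nodes is dishonest and may behave arbitrarily (a node corrupted at any time counts as dishonest). "Send" means: send to all nodes, including oneself. Thresholds count distinct senders. A vector is an element $w$ of $\{0,1,\bot\}^n$, where $\bot$ means *missing*, and $\mathcal M(w)=\{j: w[j]\ne\bot\}$. Node $i$ is given the entries $w_i[j]\in\{0,1\}$ of its input vector over time. The protocol uses the following black-box primitives. *Inputs* and *outputs* refer to honest nodes. - **Reliable broadcast** $\mathrm{RBC}_l$ with leader $l$. Any two outputs agree. If $l$ is honest and inputs $w$, every honest node eventually outputs $w$, and nothing that $l$ does not input is output for an honest $l$. If one honest node outputs, every honest node does. - **Binary Byzantine agreement** $\mathrm{ABBA}$. If all honest nodes input, all eventually output. If one honest node outputs $v$, all eventually do. If all honest nodes input the same $v$, all eventually output $v$. - **Common coin** $\mathrm{Election}_r$. If $t+1$ honest nodes activate it, every honest node that activates it outputs a common element of $[1:n]$. Any two outputs agree. *Biased agreement* $\mathrm{ABBBA}(a,b)$,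 with $a,b\in\{0,1\}$. Send $(\mathrm{VALUE},a,b)$. If $a=1$ or $b=1$, output $1$. Otherwise wait until, among the first VALUE pairs of the different senders, at least $t+1$ first bits are $1$, or at least $t+1$ second bits are $1$, or at least $n-t$ second bits are $0$. Output $1$ in the first two cases, and $0$ if only the third holds. *Dispersal (at node $i$).* All indicators $R^{(b)}[j],S^{(b)}[j],R'[j],S'[j]$ are initially $0$, and the vector $F_i$ initially has only missing entries. The handlers are: 1. On input $w_i[j]$: send $\mathrm{VOTE}(j,w_i[j])$. 2. On $t+1$ $\mathrm{VOTE}(j,b)$: send $\mathrm{VOTE}(j,b)$ if not yet sent, set $R^{(b)}[j]=1$, send $\mathrm{READY}(j,b)$. 3. On $n-t$ $\mathrm{READY}(j,b)$: set $S^{(b)}[j]=1$, send $\mathrm{FINISH}(j,b)$. 4. On $n-t$ $\mathrm{FINISH}(j,b)$ with $F_i[j]=\bot$: set $F_i[j]=b$. When exactly $n-t$ entries of $F_i$ have been set, input the current $F_i$ to $\mathrm{RBC}_i$. 5. On output of $\mathrm{RBC}_j$: set $R'[j]=1$, send $\mathrm{READY}'(j)$. 6. On $n-t$ $\mathrm{READY}'(j)$: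 set $S'[j]=1$, send $\mathrm{FINISH}'(j)$. 7. On $n-t$ $\mathrm{FINISH}'(i)$: send ELECTION (the dispersal of node $i$ is then *complete*). 8. On $n-t$ ELECTION or $t+1$ CONFIRM: send CONFIRM if not yet sent. 9. On $2t+1$ CONFIRM: send CONFIRM if not yet sent, then return. From then on all nine handlers are stopped. *Main loop.* After the dispersal has returned, for $r=1,\dots,n$: - Let $l$ be the output of $\mathrm{Election}_r$. Run $\mathrm{ABBBA}_{l,0}(R'[l],S'[l])$ and input its output to $\mathrm{ABBA}'_l$. If the latter outputs $0$, go to the next round. - Otherwise wait for $\mathrm{RBC}_l$ to output a vector $w$. If $|\mathcal M(w)|<n-t$, go to the next round. - Otherwise run $\mathrm{ABBBA}_{l,j}(R^{(w[j])}[j],S^{(w[j])}[j])$ in parallel for all $j\in\mathcal M(w)$. Input $1$ to $\mathrm{ABBA}_l$ if all of them output $1$, and $0$ otherwise. If $\mathrm{ABBA}_l$ outputs $1$, output $w$ and terminate. Otherwise go to the next round. Instances are named by the leader $l$, so an instance that a node has already run is not restarted: its old output is used. *Claim.* Consider any execution in which, for some $J\subseteq[1:n]$ with $|J|\ge n-t$,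 every honest node $i$ is eventually given a non-missing input $w_i[j]$ for every $j\in J$. Then: 1. If different rounds elect different leaders, every honest node eventually outputs a vector and terminates. 2. Without any assumption on which leaders are elected, there is a set $I^\star\subseteq[1:n]\setminus\mathcal F$ with $|I^\star|\ge n-2t$ such that the dispersals of all nodes in $I^\star$ were complete at some time at which no honest node had activated any coin, and such that: - if an honest node obtains a leader $l\in I^\star$ from $\mathrm{Election}_r$, then every honest node eventually outputs a vector and terminates, and no honest node ever reaches a round after $r$; - either every honest node eventually outputs a vector and terminates, or in each of the $n$ rounds all honest nodes elect a common leader outside $I^\star$. -/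

import Mathlib

namespace APVA

/-- A partial binary vector; `none` is the missing symbol. -/
abbrev Vec (n : ℕ) := Fin n → Option Bool

/-- The set of positions carrying a non-missing entry. -/
def nonmissing {n : ℕ} (w : Vec n) : Finset (Fin n) :=
  Finset.univ.filter fun j => (w j).isSome

/-- Names of the biased-agreement (ABBBA) instances: `(l, none)` is the instance about the
reliable broadcast of leader `l`, and `(l, some j)` the one about position `j` of the vector
of leader `l`. -/
abbrev BiasedId (n : ℕ) := Fin n × Option (Fin n)

/-- The two binary agreements (ABBA) of a leader: one on its broadcast, one on its vector. -/
inductive Stage where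
  | broadcast
  | vector
deriving DecidableEq

/-- Names of the binary-agreement instances. -/
abbrev AgreeId (n : ℕ) := Fin n × Stage

/-- Messages that the nodes exchange.  `rbcReady` and `rbcFinish` are the READY and FINISH
messages about a reliable broadcast; `ready` and `finish` those about a bit at a position. -/
inductive Msg (n : ℕ) where
  | vote (j : Fin n) (b : Bool)
  | ready (j : Fin n) (b : Bool)
  | finish (j : Fin n) (b : Bool)
  | rbcReady (j : Fin n)
  | rbcFinish (j : Fin n)
  | election
  | confirm
  | value (id : BiasedId n) (a b : Bool)
deriving DecidableEq

/-- Control point of the main loop of a node. Rounds are numbered by `Fin n`. -/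
inductive Phase (n : ℕ) where
  /-- the dispersal sub-protocol has not returned yet -/
  | dispersal
  /-- round `r`: waiting for the coin -/
  | electing (r : Fin n)
  /-- round `r`, leader `l`: waiting for the biased agreement on the broadcast of `l` -/
  | biased (r l : Fin n)
  /-- waiting for the binary agreement on the broadcast of `l` -/
  | agreeing (r l : Fin n)
  /-- waiting for the reliable broadcast of `l` to output -/
  | waiting (r l : Fin n)
  /-- waiting for the biased agreements on the non-missing positions of the vector `w` of `l` -/
  | checking (r l : Fin n) (w : Vec n)
  /-- waiting for the binary agreement on the vector `w` of `l` -/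
  | deciding (r l : Fin n) (w : Vec n)
  /-- the node has output `w` and terminated -/
  | terminated (w : Vec n)
  /-- the `n` rounds are over and nothing has been output -/
  | exhausted

/-- Local state of a node. -/
structure NodeState (n : ℕ) where
  /-- the input vector, as far as it has been provided -/
  input : Vec n
  /-- messages sent so far (always to all nodes, the sender included) -/
  sent : Finset (Msg n)
  /-- messages received so far, with their senders -/
  received : Finset (Fin n × Msg n)
  /-- for every ABBBA instance and sender, the first VALUE pair received -/
  values : BiasedId n → Fin n → Option (Bool × Bool)
  /-- the indicators `R^(b)[j]` -/
  ready : Bool → Fin n → Bool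
  /-- the indicators `S^(b)[j]` -/
  finish : Bool → Fin n → Bool
  /-- the confirmed vector of this node -/
  record : Vec n
  /-- the number of confirmed entries -/
  count : ℕ
  /-- the ready indicators of the reliable broadcasts -/
  rbcReady : Fin n → Bool
  /-- the finish indicators of the reliable broadcasts -/
  rbcFinish : Fin n → Bool
  /-- whether the dispersal sub-protocol has returned (and stopped) -/
  returned : Bool
  /-- the input of this node to the reliable broadcast that it leads -/
  rbcIn : Option (Vec n)
  /-- outputs of the reliable broadcasts, by leader -/
  rbcOut : Fin n → Option (Vec n)
  /-- inputs to the biased agreements -/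
  biasedIn : BiasedId n → Option (Bool × Bool)
  /-- outputs of the biased agreements -/
  biasedOut : BiasedId n → Option Bool
  /-- inputs to the binary agreements -/
  agreeIn : AgreeId n → Option Bool
  /-- outputs of the binary agreements -/
  agreeOut : AgreeId n → Option Bool
  /-- whether the coin of a round has been activated -/
  coinOn : Fin n → Bool
  /-- outputs of the coins -/
  coinOut : Fin n → Option (Fin n)
  /-- control point of the main loop -/
  phase : Phase n

/-- The initial state. -/
def NodeState.init (n : ℕ) : NodeState n where
  input := fun _ => none
  sent := ∅
  received := ∅
  values := fun _ _ => none
  ready := fun _ _ => false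
  finish := fun _ _ => false
  record := fun _ => none
  count := 0
  rbcReady := fun _ => false
  rbcFinish := fun _ => false
  returned := false
  rbcIn := none
  rbcOut := fun _ => none
  biasedIn := fun _ => none
  biasedOut := fun _ => none
  agreeIn := fun _ => none
  agreeOut := fun _ => none
  coinOn := fun _ => false
  coinOut := fun _ => none
  phase := .dispersal

/-- Assign the value `b` at `a` unless a value is already there. -/
def setOnce {α β : Type*} [DecidableEq α] (f : α → Option β) (a : α) (b : β) : α → Option β :=
  fun x => if x = a ∧ (f x).isNone then some b else f x

namespace NodeState

variable {n : ℕ}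

/-- Send a message to all nodes. -/
def send (s : NodeState n) (m : Msg n) : NodeState n :=
  { s with sent := insert m s.sent }

/-- The number of distinct nodes from which `m` has been received. -/
def tally (s : NodeState n) (m : Msg n) : ℕ :=
  (Finset.univ.filter fun p => (p, m) ∈ s.received).card

/-- Arrival of the message `m` from node `p`. -/
def receive (s : NodeState n) (p : Fin n) (m : Msg n) : NodeState n :=
  { s with
    received := insert (p, m) s.received
    values := match m with
      | .value id a b => fun id' =>
          if id' = id then setOnce (s.values id) p (a, b) else s.values id'
      | _ => s.values }

/-- The number of nodes whose VALUE pair `v` for the instance `id` satisfies `P`. -/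
def valueTally (s : NodeState n) (id : BiasedId n) (P : Bool × Bool → Bool) : ℕ :=
  (Finset.univ.filter fun p => (s.values id p).any P).card

/-- Start the ABBBA instances `id` with `calls id ≠ none`, on the input pair `calls id`:
the pair is sent to all nodes, and `1` is output at once if one of its two bits is `1`.
An instance that the node has already started is not started again. -/
def startBiased (s : NodeState n) (calls : BiasedId n → Option (Bool × Bool)) : NodeState n :=
  let new : BiasedId n → Option (Bool × Bool) :=
    fun id => if (s.biasedIn id).isSome then none else calls id
  { s with
    biasedIn := fun id => match new id with
      | some v => some v
      | none => s.biasedIn id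
    biasedOut := fun id => match new id with
      | some (a, b) => if a || b then some true else s.biasedOut id
      | none => s.biasedOut id
    sent := s.sent ∪ Finset.univ.biUnion fun id => match new id with
      | some (a, b) => {Msg.value id a b}
      | none => ∅ }

/-- Give the input `v` to a binary agreement. -/
def inputAgree (s : NodeState n) (id : AgreeId n) (v : Bool) : NodeState n :=
  { s with agreeIn := setOnce s.agreeIn id v }

/-- Begin round `r`: activate its coin and wait for the result. -/
def beginRound (s : NodeState n) (r : Fin n) : NodeState n :=
  { s with coinOn := Function.update s.coinOn r true, phase := .electing r }

/-- Leave round `r` without output. -/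
def leaveRound (s : NodeState n) (r : Fin n) : NodeState n :=
  if h : r.1 + 1 < n then s.beginRound ⟨r.1 + 1, h⟩ else { s with phase := .exhausted }

end NodeState

/-- The event handlers of the dispersal sub-protocol. -/
inductive Dispersal (n : ℕ) where
  | vote (j : Fin n)
  | ready (j : Fin n) (b : Bool)
  | finish (j : Fin n) (b : Bool)
  | record (j : Fin n) (b : Bool)
  | rbcReady (j : Fin n)
  | rbcFinish (j : Fin n)
  | election
  | confirm
  | amplify
  | finalize

/-- The code of the handlers of the dispersal sub-protocol at node `i`; `none` means that the
triggering condition of the handler does not hold. -/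
def Dispersal.run (n t : ℕ) (i : Fin n) (s : NodeState n) : Dispersal n → Option (NodeState n)
  | .vote j => (s.input j).map fun b => s.send (.vote j b)
  | .ready j b =>
      if t + 1 ≤ s.tally (.vote j b) then
        some (({ s with ready := fun c k => if c = b ∧ k = j then true else s.ready c k }.send
          (.vote j b)).send (.ready j b))
      else none
  | .finish j b =>
      if n - t ≤ s.tally (.ready j b) then
        some ({ s with finish := fun c k => if c = b ∧ k = j then true else s.finish c k }.send
          (.finish j b))
      else none
  | .record j b =>
      if n - t ≤ s.tally (.finish j b) ∧ s.record j = none then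
        some { s with
          record := Function.update s.record j (some b)
          count := s.count + 1
          -- when the counter reaches `n - t`, the vector is passed to the broadcast of `i`
          rbcIn := if s.count + 1 = n - t then some (Function.update s.record j (some b))
            else s.rbcIn }
      else none
  | .rbcReady j =>
      if (s.rbcOut j).isSome then
        some ({ s with rbcReady := Function.update s.rbcReady j true }.send (.rbcReady j))
      else none
  | .rbcFinish j =>
      if n - t ≤ s.tally (.rbcReady j) then
        some ({ s with rbcFinish := Function.update s.rbcFinish j true }.send (.rbcFinish j))
      else none
  | .election => if n - t ≤ s.tally (.rbcFinish i) then some (s.send .election) else none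
  | .confirm =>
      if n - t ≤ s.tally .election ∧ .confirm ∉ s.sent then some (s.send .confirm) else none
  | .amplify =>
      if t + 1 ≤ s.tally .confirm ∧ .confirm ∉ s.sent then some (s.send .confirm) else none
  | .finalize =>
      if 2 * t + 1 ≤ s.tally .confirm then some ({ s with returned := true }.send .confirm)
      else none

/-- Output of a biased agreement after waiting: `1` if at least `t + 1` first bits or at least
`t + 1` second bits equal to `1` have been received, otherwise `0` if at least `n - t` second
bits equal to `0` have been received. -/
def biasedStep (n t : ℕ) (s : NodeState n) (id : BiasedId n) : Option (NodeState n) :=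
  if (s.biasedIn id).isSome ∧ s.biasedOut id = none then
    if t + 1 ≤ s.valueTally id (fun v => v.1) ∨ t + 1 ≤ s.valueTally id (fun v => v.2) then
      some { s with biasedOut := setOnce s.biasedOut id true }
    else if n - t ≤ s.valueTally id (fun v => !v.2) then
      some { s with biasedOut := setOnce s.biasedOut id false }
    else none
  else none

/-- Input pairs to the biased agreements on the non-missing positions of the vector `w` of
leader `l`. -/
def vectorCalls {n : ℕ} (s : NodeState n) (l : Fin n) (w : Vec n) :
    BiasedId n → Option (Bool × Bool)
  | (l', some j) => if l' = l then (w j).map fun b => (s.ready b j, s.finish b j) else none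
  | (_, none) => none

/-- One step of the main loop; `none` means that the node has to wait. -/
def mainStep (n t : ℕ) (s : NodeState n) : Option (NodeState n) :=
  match s.phase with
  | .dispersal =>
      if s.returned then
        if h : 0 < n then some (s.beginRound ⟨0, h⟩) else some { s with phase := .exhausted }
      else none
  | .electing r =>
      (s.coinOut r).map fun l =>
        { s.startBiased (fun id => if id = (l, none) then some (s.rbcReady l, s.rbcFinish l)
            else none) with phase := .biased r l }
  | .biased r l =>
      (s.biasedOut (l, none)).map fun v =>
        { s.inputAgree (l, .broadcast) v with phase := .agreeing r l }
  | .agreeing r l =>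
      (s.agreeOut (l, .broadcast)).map fun v =>
        if v then { s with phase := .waiting r l } else s.leaveRound r
  | .waiting r l =>
      (s.rbcOut l).map fun w =>
        if n - t ≤ (nonmissing w).card then
          { s.startBiased (vectorCalls s l w) with phase := .checking r l w }
        else s.leaveRound r
  | .checking r l w =>
      if ∀ j ∈ nonmissing w, (s.biasedOut (l, some j)).isSome then
        some { s.inputAgree (l, .vector)
            (decide (∀ j ∈ nonmissing w, s.biasedOut (l, some j) = some true)) with
          phase := .deciding r l w }
      else none
  | .deciding r l w =>
      (s.agreeOut (l, .vector)).map fun v =>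
        if v then { s with phase := .terminated w } else s.leaveRound r
  | .terminated _ => none
  | .exhausted => none

/-- All pieces of code that a node runs. -/
inductive Handler (n : ℕ) where
  | dispersal (h : Dispersal n)
  | biased (id : BiasedId n)
  | main

/-- Run a handler at node `i`; `none` means that it is not enabled. The handlers of the dispersal
sub-protocol are disabled once it has returned. -/
def Handler.run (n t : ℕ) (i : Fin n) (s : NodeState n) : Handler n → Option (NodeState n)
  | .dispersal h => if s.returned then none else h.run n t i s
  | .biased id => biasedStep n t s id
  | .main => mainStep n t s

/-- `LocalStep n t F σ i s`: in the global state `σ`, one event at the honest node `i` can turn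
its state into `s`. The set of dishonest nodes is `F`; these may send any message to any node
at any time. -/
inductive LocalStep (n t : ℕ) (F : Finset (Fin n)) (σ : Fin n → NodeState n) (i : Fin n) :
    NodeState n → Prop
  /-- an entry of the input vector is provided -/
  | input (j : Fin n) (b : Bool) :
      LocalStep n t F σ i { σ i with input := setOnce (σ i).input j b }
  /-- a message arrives -/
  | deliver (p : Fin n) (m : Msg n) (h : p ∈ F ∨ m ∈ (σ p).sent) :
      LocalStep n t F σ i ((σ i).receive p m)
  /-- a reliable broadcast outputs -/
  | rbc (l : Fin n) (w : Vec n) :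
      LocalStep n t F σ i { σ i with rbcOut := setOnce (σ i).rbcOut l w }
  /-- a binary agreement outputs -/
  | agree (id : AgreeId n) (v : Bool) :
      LocalStep n t F σ i { σ i with agreeOut := setOnce (σ i).agreeOut id v }
  /-- an activated coin outputs -/
  | coin (r l : Fin n) (h : (σ i).coinOn r = true) :
      LocalStep n t F σ i { σ i with coinOut := setOnce (σ i).coinOut r l }
  /-- the node runs an enabled handler -/
  | handler (a : Handler n) (s : NodeState n) (h : a.run n t i (σ i) = some s) :
      LocalStep n t F σ i s

/-- Reliable broadcast: `input v` says that the leader inputs `v` (at some time) and `output i v`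
that node `i` outputs `v` (at some time). -/
structure ReliableBroadcast {n : ℕ} {V : Type*} (F : Finset (Fin n)) (leader : Fin n)
    (input : V → Prop) (output : Fin n → V → Prop) : Prop where
  consistency : ∀ i ∉ F, ∀ k ∉ F, ∀ v w, output i v → output k w → v = w
  validity : leader ∉ F → ∀ v, input v → ∀ i ∉ F, output i v
  /-- validity also means that nothing is output in the name of an honest leader which that
  leader does not input -/
  integrity : leader ∉ F → ∀ i ∉ F, ∀ v, output i v → input v
  totality : ∀ i ∉ F, ∀ v, output i v → ∀ k ∉ F, ∃ w, output k w

/-- Byzantine agreement. -/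
structure ByzantineAgreement {n : ℕ} {V : Type*} (F : Finset (Fin n))
    (input output : Fin n → V → Prop) : Prop where
  termination : (∀ i ∉ F, ∃ v, input i v) → ∀ i ∉ F, ∃ v, output i v
  consistency : ∀ i ∉ F, ∀ v, output i v → ∀ k ∉ F, output k v
  validity : ∀ v, (∀ i ∉ F, input i v) → ∀ i ∉ F, output i v

/-- Common coin with values in the set of nodes. -/
structure CommonCoin {n : ℕ} (t : ℕ) (F : Finset (Fin n))
    (active : Fin n → Prop) (output : Fin n → Fin n → Prop) : Prop where
  termination : ∀ A : Finset (Fin n), t + 1 ≤ A.card → (∀ i ∈ A, i ∉ F ∧ active i) →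
    ∃ l, ∀ i ∉ F, active i → output i l
  consistency : ∀ i ∉ F, ∀ k ∉ F, ∀ l l', output i l → output k l' → l = l'

/-- A complete (infinite) asynchronous execution of the APVA protocol among `n` nodes with
resilience parameter `t` and set `F` of dishonest nodes. -/
structure Execution (n t : ℕ) (F : Finset (Fin n)) where
  /-- the states of all nodes at every time (those of the dishonest nodes play no role) -/
  state : ℕ → Fin n → NodeState n
  init : ∀ i ∉ F, state 0 i = NodeState.init n
  step : ∀ k, state (k + 1) = state k ∨
    ∃ i ∉ F, ∃ s, LocalStep n t F (state k) i s ∧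
      state (k + 1) = Function.update (state k) i s
  /-- messages between honest nodes eventually arrive -/
  delivery : ∀ p ∉ F, ∀ i ∉ F, ∀ k m, m ∈ (state k p).sent →
    ∃ k', (p, m) ∈ (state k' i).received
  /-- a handler of an honest node that stays enabled is eventually run -/
  progress : ∀ i ∉ F, ∀ (a : Handler n) (k : ℕ),
    (∀ k' ≥ k, (a.run n t i (state k' i)).isSome) →
      ∃ k' ≥ k, a.run n t i (state k' i) = some (state (k' + 1) i)
  rbc : ∀ l, ReliableBroadcast F l (fun w => ∃ k, (state k l).rbcIn = some w)
    (fun i w => ∃ k, (state k i).rbcOut l = some w)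
  agree : ∀ id, ByzantineAgreement F (fun i v => ∃ k, (state k i).agreeIn id = some v)
    (fun i v => ∃ k, (state k i).agreeOut id = some v)
  coin : ∀ r, CommonCoin t F (fun i => ∃ k, (state k i).coinOn r = true)
    (fun i l => ∃ k, (state k i).coinOut r = some l)

namespace Execution

variable {n t : ℕ} {F : Finset (Fin n)} (E : Execution n t F)

/-- Node `i` eventually outputs a vector and terminates. -/
def Terminates (i : Fin n) : Prop := ∃ k w, (E.state k i).phase = .terminated w

/-- Node `i` obtains the leader `l` from the coin of round `r`. -/
def Elects (i r l : Fin n) : Prop := ∃ k, (E.state k i).coinOut r = some l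

/-- Node `i` reaches round `r`. -/
def Reaches (i r : Fin n) : Prop := ∃ k, (E.state k i).coinOn r = true

/-- Different rounds elect different leaders. -/
def DistinctLeaders : Prop :=
  ∀ i ∉ F, ∀ k ∉ F, ∀ r r' l, E.Elects i r l → E.Elects k r' l → r = r'

/-- All honest nodes eventually input non-missing values at at least `n - t` common positions. -/
def CommonInputs : Prop :=
  ∃ J : Finset (Fin n), n - t ≤ J.card ∧
    ∀ i ∉ F, ∀ j ∈ J, ∃ k, ((E.state k i).input j).isSome

/-- `I` is a set of honest nodes whose dispersals were complete (that is, which had sent their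
ELECTION message) at a time when no honest node had activated any coin. -/
def Completed (I : Finset (Fin n)) : Prop :=
  (∀ l ∈ I, l ∉ F) ∧
  ∃ k, (∀ l ∈ I, Msg.election ∈ (E.state k l).sent) ∧
    ∀ i ∉ F, ∀ r, (E.state k i).coinOn r = false

end Execution

end APVA

/-! ### Write-once fields and the transitions of one node -/

namespace APVA

variable {n t : ℕ} {i : Fin n}

open NodeState

/-! The argument combines quorum counting with persistence. Almost everything a node writes is
permanent, so local facts become inductive invariants. Two facts established at different times can
be compared at a later common time, and a permanently enabled handler is eventually run.

Dispersal. Suppose no honest node ever returned. For a position with inputs everywhere, the at least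
`2t+1` honest votes split over two bits, so one bit gets `t+1` of them. The READY/FINISH cascade
then fills that position at every honest node. Hence every honest broadcast is started and
acknowledged, all honest nodes send ELECTION and CONFIRM, and they return. If instead one honest
node returns, `t+1` honest CONFIRMs spread by amplification (`exists_returned`). Just before the
first return some honest node has already counted `n-t` ELECTION messages. Their honest senders, at
least `n-2t`, form the set `I`, and no honest coin is active yet (`exists_completed`).

Biased agreement. The indicators are frozen on return, so input pairs reflect final values. A second
bit `1` at an honest node means `n-t` READYs, hence at least `t+1` honest first bits `1`; otherwise
every honest second bit is `0`. Either way every honest node gets an output once all honest nodes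
have started the instance (`eventually_biasedOut`). If `t+1` honest second bits are `1`, there are
too few zeros left for output `0` (`biasedOut_ne_false`).

Rounds. When all honest nodes reach a round they move through its phases together. A binary
agreement returns the input of some honest node. Output `1` on the broadcast is backed by an honest
indicator, so the broadcast really delivers and nobody waits in vain. Thus all honest nodes output
or all leave (`round_dichotomy`). If the dispersal of an honest leader completes, `n-t` FINISH
messages stand behind its broadcast and behind each entry of its vector. So no biased agreement
about it outputs `0`, and the round succeeds (`Good.succeeds`).

Conclusion. If some honest node does not terminate, no round succeeds, so all `n` rounds are run
with leaders outside `I`. Distinct leaders would exhaust all nodes and therefore meet the nonempty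
`I`. -/

theorem setOnce_eq_some {α β : Type*} [DecidableEq α] {f : α → Option β} {a x : α} {b c : β} :
    setOnce f a b x = some c ↔ f x = some c ∨ (f x = none ∧ x = a ∧ b = c) := by
  unfold setOnce
  split_ifs with h
  · rcases h with ⟨rfl, h⟩
    cases hf : f x <;> simp_all
  · cases hf : f x <;> simp_all

theorem setOnce_of_some {α β : Type*} [DecidableEq α] {f : α → Option β} {a x : α} {b c : β}
    (h : f x = some c) : setOnce f a b x = some c :=
  setOnce_eq_some.2 (.inl h)

theorem isSome_setOnce_self {α β : Type*} [DecidableEq α] (f : α → Option β) (a : α) (b : β) :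
    (setOnce f a b a).isSome := by
  unfold setOnce
  cases hf : f a <;> simp

/-- Round `r` has been left without output. -/
def NodeState.Passed (t : ℕ) (s : NodeState n) (r : Fin n) : Prop :=
  ∃ l, s.coinOut r = some l ∧ (s.agreeOut (l, .broadcast) = some false ∨
    s.agreeOut (l, .broadcast) = some true ∧ ∃ w, s.rbcOut l = some w ∧
      ((nonmissing w).card < n - t ∨ s.agreeOut (l, .vector) = some false ∧
        n - t ≤ (nonmissing w).card))

/-- The main loop is about to leave round `r`, with leader `l`, without output. -/
def NodeState.Leaves (t : ℕ) (s : NodeState n) (r l : Fin n) : Prop :=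
  (s.phase = .agreeing r l ∧ s.agreeOut (l, .broadcast) = some false) ∨
  (∃ w, s.phase = .waiting r l ∧ s.rbcOut l = some w ∧ (nonmissing w).card < n - t) ∨
  (∃ w, s.phase = .deciding r l w ∧ s.agreeOut (l, .vector) = some false)

/-- The steps of a node `i`, one constructor per piece of code; `ok p m` says that the message `m`
may arrive from `p`. -/
inductive Transition (n t : ℕ) (i : Fin n) (ok : Fin n → Msg n → Prop) (s : NodeState n) :
    NodeState n → Prop
  | input (j : Fin n) (b : Bool) : Transition n t i ok s { s with input := setOnce s.input j b }
  | deliver (p : Fin n) (m : Msg n) (h : ok p m) : Transition n t i ok s (s.receive p m)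
  | rbc (l : Fin n) (w : Vec n) : Transition n t i ok s { s with rbcOut := setOnce s.rbcOut l w }
  | agree (id : AgreeId n) (v : Bool) :
      Transition n t i ok s { s with agreeOut := setOnce s.agreeOut id v }
  | coin (r l : Fin n) (h : s.coinOn r = true) :
      Transition n t i ok s { s with coinOut := setOnce s.coinOut r l }
  | vote (j : Fin n) (b : Bool) (hr : s.returned = false) :
      Transition n t i ok s (s.send (.vote j b))
  | ready (j : Fin n) (b : Bool) (hr : s.returned = false) :
      Transition n t i ok s
        (({ s with ready := fun c k => if c = b ∧ k = j then true else s.ready c k }.send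
          (.vote j b)).send (.ready j b))
  | finish (j : Fin n) (b : Bool) (hr : s.returned = false) (h : n - t ≤ s.tally (.ready j b)) :
      Transition n t i ok s
        ({ s with finish := fun c k => if c = b ∧ k = j then true else s.finish c k }.send
          (.finish j b))
  | record (j : Fin n) (b : Bool) (hr : s.returned = false) (h : n - t ≤ s.tally (.finish j b))
      (hj : s.record j = none) :
      Transition n t i ok s { s with
          record := Function.update s.record j (some b)
          count := s.count + 1
          rbcIn := if s.count + 1 = n - t then some (Function.update s.record j (some b))
            else s.rbcIn }
  | rbcReady (j : Fin n) (hr : s.returned = false) (h : (s.rbcOut j).isSome) :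
      Transition n t i ok s
        ({ s with rbcReady := Function.update s.rbcReady j true }.send (.rbcReady j))
  | rbcFinish (j : Fin n) (hr : s.returned = false) (h : n - t ≤ s.tally (.rbcReady j)) :
      Transition n t i ok s
        ({ s with rbcFinish := Function.update s.rbcFinish j true }.send (.rbcFinish j))
  | election (hr : s.returned = false) (h : n - t ≤ s.tally (.rbcFinish i)) :
      Transition n t i ok s (s.send .election)
  | confirm (hr : s.returned = false)
      (h : n - t ≤ s.tally .election ∨ t + 1 ≤ s.tally .confirm) :
      Transition n t i ok s (s.send .confirm)
  | finalize (hr : s.returned = false) (h : 2 * t + 1 ≤ s.tally .confirm) :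
      Transition n t i ok s ({ s with returned := true }.send .confirm)
  | biasedTrue (id : BiasedId n) (hi : (s.biasedIn id).isSome) (ho : s.biasedOut id = none)
      (h : t + 1 ≤ s.valueTally id (fun v => v.1) ∨ t + 1 ≤ s.valueTally id (fun v => v.2)) :
      Transition n t i ok s { s with biasedOut := setOnce s.biasedOut id true }
  | biasedFalse (id : BiasedId n) (hi : (s.biasedIn id).isSome) (ho : s.biasedOut id = none)
      (h : n - t ≤ s.valueTally id (fun v => !v.2)) :
      Transition n t i ok s { s with biasedOut := setOnce s.biasedOut id false }
  | start (h : 0 < n) (hp : s.phase = .dispersal) (hr : s.returned = true) :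
      Transition n t i ok s (s.beginRound ⟨0, h⟩)
  | elect (r l : Fin n) (hp : s.phase = .electing r) (h : s.coinOut r = some l) :
      Transition n t i ok s
        { s.startBiased (fun id => if id = (l, none) then some (s.rbcReady l, s.rbcFinish l)
            else none) with phase := .biased r l }
  | propose (r l : Fin n) (v : Bool) (hp : s.phase = .biased r l)
      (h : s.biasedOut (l, none) = some v) :
      Transition n t i ok s { s.inputAgree (l, .broadcast) v with phase := .agreeing r l }
  | await (r l : Fin n) (hp : s.phase = .agreeing r l)
      (h : s.agreeOut (l, .broadcast) = some true) :
      Transition n t i ok s { s with phase := .waiting r l }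
  | examine (r l : Fin n) (w : Vec n) (hp : s.phase = .waiting r l) (h : s.rbcOut l = some w)
      (hw : n - t ≤ (nonmissing w).card) :
      Transition n t i ok s { s.startBiased (vectorCalls s l w) with phase := .checking r l w }
  | judge (r l : Fin n) (w : Vec n) (hp : s.phase = .checking r l w)
      (h : ∀ j ∈ nonmissing w, (s.biasedOut (l, some j)).isSome) :
      Transition n t i ok s { s.inputAgree (l, .vector)
            (decide (∀ j ∈ nonmissing w, s.biasedOut (l, some j) = some true)) with
          phase := .deciding r l w }
  | terminate (r l : Fin n) (w : Vec n) (hp : s.phase = .deciding r l w)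
      (h : s.agreeOut (l, .vector) = some true) :
      Transition n t i ok s { s with phase := .terminated w }
  | leave (r l : Fin n) (h : s.Leaves t r l) : Transition n t i ok s (s.leaveRound r)

theorem Transition.of_mainStep {ok : Fin n → Msg n → Prop} {s s' : NodeState n}
    (h : mainStep n t s = some s') : Transition n t i ok s s' := by
  unfold mainStep at h
  split at h
  next hp =>
    -- The branch for `n = 0` cannot occur, since the node `i` exists.
    have h0 : 0 < n := i.pos
    split_ifs at h with hr
    cases h
    exact .start h0 hp hr
  next r hp =>
    obtain ⟨l, hl, rfl⟩ := Option.map_eq_some_iff.1 h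
    exact .elect r l hp hl
  next r l hp =>
    obtain ⟨v, hv, rfl⟩ := Option.map_eq_some_iff.1 h
    exact .propose r l v hp hv
  next r l hp =>
    obtain ⟨v, hv, rfl⟩ := Option.map_eq_some_iff.1 h
    cases v
    · exact .leave r l (.inl ⟨hp, hv⟩)
    · exact .await r l hp hv
  next r l hp =>
    obtain ⟨w, hw, rfl⟩ := Option.map_eq_some_iff.1 h
    split_ifs with hc
    · exact .examine r l w hp hw hc
    · exact .leave r l (.inr (.inl ⟨w, hp, hw, not_le.1 hc⟩))
  next r l w hp =>
    split_ifs at h with hj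
    cases h
    exact .judge r l w hp hj
  next r l w hp =>
    obtain ⟨v, hv, rfl⟩ := Option.map_eq_some_iff.1 h
    cases v
    · exact .leave r l (.inr (.inr ⟨w, hp, hv⟩))
    · exact .terminate r l w hp hv
  next => cases h
  next => cases h

theorem LocalStep.transition {F : Finset (Fin n)} {σ : Fin n → NodeState n} {s' : NodeState n}
    (h : LocalStep n t F σ i s') :
    Transition n t i (fun p m => p ∈ F ∨ m ∈ (σ p).sent) (σ i) s' := by
  cases h with
  | input j b => exact .input j b
  | deliver p m h => exact .deliver p m h
  | rbc l w => exact .rbc l w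
  | agree id v => exact .agree id v
  | coin r l h => exact .coin r l h
  | handler a s h =>
    cases a with
    | main => exact .of_mainStep h
    | biased id =>
      simp only [Handler.run, biasedStep] at h
      split_ifs at h with h1 h2 h3
      · cases h; exact .biasedTrue id h1.1 h1.2 h2
      · cases h; exact .biasedFalse id h1.1 h1.2 h3
    | dispersal d =>
      simp only [Handler.run] at h
      split_ifs at h with hr
      rw [Bool.not_eq_true] at hr
      cases d with
      | vote j =>
        obtain ⟨b, -, rfl⟩ := Option.map_eq_some_iff.1 h
        exact .vote j b hr
      | ready j b =>
        simp only [Dispersal.run] at h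
        split_ifs at h with hc
        cases h; exact .ready j b hr
      | finish j b =>
        simp only [Dispersal.run] at h
        split_ifs at h with hc
        cases h; exact .finish j b hr hc
      | record j b =>
        simp only [Dispersal.run] at h
        split_ifs at h with hc
        all_goals cases h
        all_goals
          have := Transition.record (i := i)
            (ok := fun p m => p ∈ F ∨ m ∈ (σ p).sent) j b hr hc.1 hc.2
          simpa [*] using this
      | rbcReady j =>
        simp only [Dispersal.run] at h
        split_ifs at h with hc
        cases h; exact .rbcReady j hr hc
      | rbcFinish j =>
        simp only [Dispersal.run] at h
        split_ifs at h with hc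
        cases h; exact .rbcFinish j hr hc
      | election =>
        simp only [Dispersal.run] at h
        split_ifs at h with hc
        cases h; exact .election hr hc
      | confirm =>
        simp only [Dispersal.run] at h
        split_ifs at h with hc
        cases h; exact .confirm hr (.inl hc.1)
      | amplify =>
        simp only [Dispersal.run] at h
        split_ifs at h with hc
        cases h; exact .confirm hr (.inr hc.1)
      | finalize =>
        simp only [Dispersal.run] at h
        split_ifs at h with hc
        cases h; exact .finalize hr hc

/-! ### Persistence of local data -/

/-- `s'` is a later state than `s`: nothing that has been written is erased, and the indicators do
not change once the dispersal has returned. -/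
structure Extends (s s' : NodeState n) : Prop where
  input : ∀ j, (s.input j).isSome → (s'.input j).isSome
  sent : s.sent ⊆ s'.sent
  received : s.received ⊆ s'.received
  values : ∀ id p v, s.values id p = some v → s'.values id p = some v
  ready : ∀ b j, s.ready b j = true → s'.ready b j = true
  finish : ∀ b j, s.finish b j = true → s'.finish b j = true
  record : ∀ j b, s.record j = some b → s'.record j = some b
  rbcReady : ∀ j, s.rbcReady j = true → s'.rbcReady j = true
  rbcFinish : ∀ j, s.rbcFinish j = true → s'.rbcFinish j = true
  returned : s.returned = true → s'.returned = true ∧ s'.ready = s.ready ∧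
    s'.finish = s.finish ∧ s'.rbcReady = s.rbcReady ∧ s'.rbcFinish = s.rbcFinish
  rbcIn : s.rbcIn.isSome → s'.rbcIn.isSome
  rbcOut : ∀ l w, s.rbcOut l = some w → s'.rbcOut l = some w
  biasedIn : ∀ id v, s.biasedIn id = some v → s'.biasedIn id = some v
  biasedOut : ∀ id, (s.biasedOut id).isSome → (s'.biasedOut id).isSome
  -- Starting an instance may overwrite its output field, so a value is stable only after the
  -- instance has an input. `BiasedInv.out_in` will show that every output has one.
  biasedOut_eq : ∀ id v, (s.biasedIn id).isSome → s.biasedOut id = some v →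
    s'.biasedOut id = some v
  agreeIn : ∀ id v, s.agreeIn id = some v → s'.agreeIn id = some v
  agreeOut : ∀ id v, s.agreeOut id = some v → s'.agreeOut id = some v
  coinOn : ∀ r, s.coinOn r = true → s'.coinOn r = true
  coinOut : ∀ r l, s.coinOut r = some l → s'.coinOut r = some l

theorem Extends.refl (s : NodeState n) : Extends s s := by
  constructor <;> simp

theorem Extends.trans {s s' s'' : NodeState n} (h : Extends s s') (h' : Extends s' s'') :
    Extends s s'' where
  input j hj := h'.input j (h.input j hj)
  sent := h.sent.trans h'.sent
  received := h.received.trans h'.received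
  values id p v hv := h'.values id p v (h.values id p v hv)
  ready b j hj := h'.ready b j (h.ready b j hj)
  finish b j hj := h'.finish b j (h.finish b j hj)
  record j b hj := h'.record j b (h.record j b hj)
  rbcReady j hj := h'.rbcReady j (h.rbcReady j hj)
  rbcFinish j hj := h'.rbcFinish j (h.rbcFinish j hj)
  returned hr := by
    obtain ⟨h1, h2, h3, h4, h5⟩ := h.returned hr
    obtain ⟨k1, k2, k3, k4, k5⟩ := h'.returned h1
    exact ⟨k1, k2.trans h2, k3.trans h3, k4.trans h4, k5.trans h5⟩
  rbcIn hs := h'.rbcIn (h.rbcIn hs)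
  rbcOut l w hw := h'.rbcOut l w (h.rbcOut l w hw)
  biasedIn id v hv := h'.biasedIn id v (h.biasedIn id v hv)
  biasedOut id hv := h'.biasedOut id (h.biasedOut id hv)
  biasedOut_eq id v hi hv := by
    obtain ⟨u, hu⟩ := Option.isSome_iff_exists.1 hi
    exact h'.biasedOut_eq id v (by simp [h.biasedIn id u hu]) (h.biasedOut_eq id v hi hv)
  agreeIn id v hv := h'.agreeIn id v (h.agreeIn id v hv)
  agreeOut id v hv := h'.agreeOut id v (h.agreeOut id v hv)
  coinOn r hr := h'.coinOn r (h.coinOn r hr)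
  coinOut r l hl := h'.coinOut r l (h.coinOut r l hl)

theorem isSome_setOnce {α β : Type*} [DecidableEq α] {f : α → Option β} {a x : α} {b : β}
    (h : (f x).isSome) : (setOnce f a b x).isSome := by
  obtain ⟨c, hc⟩ := Option.isSome_iff_exists.1 h
  simp [setOnce_of_some hc]

theorem extends_send (s : NodeState n) (m : Msg n) : Extends s (s.send m) := by
  constructor <;> simp +contextual [send]

theorem extends_receive (s : NodeState n) (p : Fin n) (m : Msg n) :
    Extends s (s.receive p m) := by
  constructor <;> simp +contextual [receive, -Prod.forall, -Bool.forall_bool]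
  intro id q v h
  cases m <;> simp only [h]
  split_ifs with hid
  · subst hid; exact setOnce_of_some h
  · exact h

theorem extends_startBiased (s : NodeState n) (c : BiasedId n → Option (Bool × Bool)) :
    Extends s (s.startBiased c) := by
  constructor <;> simp +contextual [startBiased, -Prod.forall, -Bool.forall_bool]
  · intro id h
    cases hi : s.biasedIn id <;> simp [h]
    cases hc : c id <;> simp [h]
    split_ifs <;> simp [h]

theorem extends_phase (s : NodeState n) (p : Phase n) : Extends s { s with phase := p } := by
  constructor <;> simp

theorem extends_beginRound (s : NodeState n) (r : Fin n) : Extends s (s.beginRound r) := by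
  constructor <;> simp +contextual [beginRound, Function.update_apply]

theorem extends_leaveRound (s : NodeState n) (r : Fin n) : Extends s (s.leaveRound r) := by
  unfold leaveRound
  split_ifs
  · exact extends_beginRound s _
  · exact extends_phase s _

theorem extends_inputAgree (s : NodeState n) (id : AgreeId n) (v : Bool) :
    Extends s (s.inputAgree id v) := by
  constructor <;> simp +contextual [inputAgree, setOnce_of_some]

theorem Transition.extends {ok : Fin n → Msg n → Prop} {s s' : NodeState n}
    (h : Transition n t i ok s s') : Extends s s' := by
  cases h with
  | input j b => constructor <;> simp +contextual [isSome_setOnce]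
  | deliver p m h => exact extends_receive s p m
  | rbc l w => constructor <;> simp +contextual [setOnce_of_some]
  | agree id v =>
    constructor <;> simp +contextual [setOnce_of_some]
  | coin r l h => constructor <;> simp +contextual [setOnce_of_some]
  | vote j b hr => exact extends_send _ _
  | ready j b hr =>
    refine .trans ?_ (.trans (extends_send _ _) (extends_send _ _))
    constructor <;> simp +contextual [hr]
  | finish j b hr h =>
    refine .trans ?_ (extends_send _ _)
    constructor <;> simp +contextual [hr]
  | record j b hr h hj =>
    constructor <;> simp +contextual [hr, Function.update_apply]
    · rintro k; constructor <;> rintro hk rfl <;> simp_all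
    · intro h; split_ifs <;> simp_all
  | rbcReady j hr h =>
    refine .trans ?_ (extends_send _ _)
    constructor <;> simp +contextual [hr, Function.update_apply]
  | rbcFinish j hr h =>
    refine .trans ?_ (extends_send _ _)
    constructor <;> simp +contextual [hr, Function.update_apply]
  | election hr h => exact extends_send _ _
  | confirm hr h => exact extends_send _ _
  | finalize hr h =>
    refine .trans ?_ (extends_send _ _)
    constructor <;> simp +contextual
  | biasedTrue id hi ho h =>
    constructor <;> simp +contextual [setOnce_of_some]
    exact fun _ _ => isSome_setOnce
  | biasedFalse id hi ho h =>
    constructor <;> simp +contextual [setOnce_of_some]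
    exact fun _ _ => isSome_setOnce
  | start h hp hr => exact extends_beginRound _ _
  | elect r l hp h => exact (extends_startBiased _ _).trans (extends_phase _ _)
  | propose r l v hp h => exact (extends_inputAgree _ _ _).trans (extends_phase _ _)
  | await r l hp h => exact extends_phase _ _
  | examine r l w hp h hw => exact (extends_startBiased _ _).trans (extends_phase _ _)
  | judge r l w hp h => exact (extends_inputAgree _ _ _).trans (extends_phase _ _)
  | terminate r l w hp h => exact extends_phase _ _
  | leave r l h => exact extends_leaveRound _ _

theorem Extends.tally {s s' : NodeState n} (h : Extends s s') (m : Msg n) :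
    s.tally m ≤ s'.tally m :=
  Finset.card_le_card fun p hp => by
    simp only [Finset.mem_filter, Finset.mem_univ, true_and] at hp ⊢
    exact h.received hp

theorem Extends.valueTally {s s' : NodeState n} (h : Extends s s') (id : BiasedId n)
    (P : Bool × Bool → Bool) : s.valueTally id P ≤ s'.valueTally id P :=
  Finset.card_le_card fun p hp => by
    simp only [Finset.mem_filter, Finset.mem_univ, true_and, Option.any_eq_true] at hp ⊢
    obtain ⟨v, hv, hP⟩ := hp
    exact ⟨v, h.values id p v hv, hP⟩

theorem Extends.passed {s s' : NodeState n} (h : Extends s s') {r : Fin n}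
    (hr : s.Passed t r) : s'.Passed t r := by
  obtain ⟨l, hl, h1 | ⟨h1, w, hw, h2⟩⟩ := hr
  · exact ⟨l, h.coinOut _ _ hl, .inl (h.agreeOut _ _ h1)⟩
  · exact ⟨l, h.coinOut _ _ hl, .inr ⟨h.agreeOut _ _ h1, w, h.rbcOut _ _ hw,
      h2.imp id fun h3 => ⟨h.agreeOut _ _ h3.1, h3.2⟩⟩⟩

/-! ### Which transitions write which fields -/

theorem receive_sent (s : NodeState n) (p : Fin n) (m : Msg n) :
    (s.receive p m).sent = s.sent := rfl

theorem receive_finish (s : NodeState n) (p : Fin n) (m : Msg n) :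
    (s.receive p m).finish = s.finish := rfl

theorem receive_record (s : NodeState n) (p : Fin n) (m : Msg n) :
    (s.receive p m).record = s.record ∧ (s.receive p m).count = s.count ∧
      (s.receive p m).rbcIn = s.rbcIn := ⟨rfl, rfl, rfl⟩

theorem receive_rbcReady (s : NodeState n) (p : Fin n) (m : Msg n) :
    (s.receive p m).rbcReady = s.rbcReady := rfl

theorem receive_rbcFinish (s : NodeState n) (p : Fin n) (m : Msg n) :
    (s.receive p m).rbcFinish = s.rbcFinish := rfl

theorem receive_returned (s : NodeState n) (p : Fin n) (m : Msg n) :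
    (s.receive p m).returned = s.returned := rfl

theorem mem_sent_startBiased {s : NodeState n} {c : BiasedId n → Option (Bool × Bool)}
    {m : Msg n} (h : m ∈ (s.startBiased c).sent) : m ∈ s.sent ∨
      ∃ id a b, m = .value id a b ∧ (s.startBiased c).biasedIn id = some (a, b) := by
  simp only [startBiased, Finset.mem_union, Finset.mem_biUnion, Finset.mem_univ, true_and] at h ⊢
  refine h.imp id ?_
  rintro ⟨id, hid⟩
  split at hid
  next a b hn => exact ⟨id, a, b, by simpa using hid, by simp [hn]⟩
  next => simp at hid

/-- Why a message may be sent by a step that ends in the state `s'`. -/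
def Cause (n t : ℕ) (i : Fin n) (s' : NodeState n) : Msg n → Prop
  | .vote _ _ => True
  | .ready j b => s'.ready b j = true
  | .finish j b => s'.finish b j = true
  | .rbcReady j => s'.rbcReady j = true
  | .rbcFinish j => s'.rbcFinish j = true
  | .election => n - t ≤ s'.tally (.rbcFinish i)
  | .confirm => n - t ≤ s'.tally .election ∨ t + 1 ≤ s'.tally .confirm
  | .value id a b => s'.biasedIn id = some (a, b)

/-- The justification is evaluated after the step. An old message then inherits its justification by
persistence, and a new one has it at once, which yields all the `sent_*` invariants. -/
theorem Transition.cause {ok : Fin n → Msg n → Prop} {s s' : NodeState n}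
    (h : Transition n t i ok s s') {m : Msg n} (hm : m ∈ s'.sent) :
    m ∈ s.sent ∨ Cause n t i s' m := by
  cases h with
  | ready j b hr =>
    simp only [send, Finset.mem_insert] at hm
    rcases hm with rfl | rfl | hm
    · exact .inr (by simp [Cause, send])
    · exact .inr trivial
    · exact .inl hm
  | elect r l hp h =>
    obtain hm | ⟨id, a, b, rfl, h⟩ := mem_sent_startBiased (s := s) (c := fun id =>
      if id = (l, none) then some (s.rbcReady l, s.rbcFinish l) else none) hm
    · exact .inl hm
    · exact .inr h
  | examine r l w hp h hw =>
    obtain hm | ⟨id, a, b, rfl, h⟩ := mem_sent_startBiased (s := s) (c := vectorCalls s l w) hm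
    · exact .inl hm
    · exact .inr h
  | leave r l h =>
    unfold leaveRound at hm
    split_ifs at hm <;> exact .inl hm
  | input | deliver | rbc | agree | coin | record | biasedTrue | biasedFalse | start | propose
  | await | judge | terminate => exact .inl hm
  | _ =>
    simp only [send, Finset.mem_insert] at hm
    rcases hm with rfl | hm
    · refine .inr ?_
      simp only [Cause, send, Function.update_self, and_self, if_true]
      -- The second alternative serves `finalize`: `2 * t + 1` CONFIRM messages are in particular `t
      -- + 1`.
      try first | assumption | exact .inr (by simp only [tally] at *; omega)
    · exact .inl hm

theorem nonmissing_update {w : Vec n} {j : Fin n} {b : Bool} :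
    nonmissing (Function.update w j (some b)) = insert j (nonmissing w) := by
  ext k
  by_cases hk : k = j
  · subst hk; simp [nonmissing]
  · simp [nonmissing, hk]

theorem card_nonmissing_update {w : Vec n} {j : Fin n} {b : Bool} (h : w j = none) :
    (nonmissing (Function.update w j (some b))).card = (nonmissing w).card + 1 := by
  rw [nonmissing_update, Finset.card_insert_of_notMem]
  simp [nonmissing, h]

theorem Transition.returned_effect {ok : Fin n → Msg n → Prop} {s s' : NodeState n}
    (h : Transition n t i ok s s') (hs : s'.returned = true) :
    s.returned = true ∨ (.confirm ∈ s'.sent ∧ 2 * t + 1 ≤ s.tally .confirm) := by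
  cases h <;> grind [send, startBiased, inputAgree, beginRound, leaveRound, receive_sent,
    receive_finish, receive_record, receive_rbcReady, receive_rbcFinish, receive_returned,
    Function.update_apply]

theorem Transition.finish_effect {ok : Fin n → Msg n → Prop} {s s' : NodeState n}
    (h : Transition n t i ok s s') {j : Fin n} {b : Bool} (hs : s'.finish b j = true) :
    s.finish b j = true ∨ n - t ≤ s.tally (.ready j b) := by
  cases h <;> grind [send, startBiased, inputAgree, beginRound, leaveRound, receive_sent,
    receive_finish, receive_record, receive_rbcReady, receive_rbcFinish, receive_returned,
    Function.update_apply]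

theorem Transition.rbcReady_effect {ok : Fin n → Msg n → Prop} {s s' : NodeState n}
    (h : Transition n t i ok s s') {j : Fin n} (hs : s'.rbcReady j = true) :
    s.rbcReady j = true ∨ (s.rbcOut j).isSome := by
  cases h with
  | rbcReady k hr h =>
    simp only [send, Function.update_apply] at hs
    grind
  | _ => grind [send, startBiased, inputAgree, beginRound, leaveRound, receive_sent,
    receive_finish, receive_record, receive_rbcReady, receive_rbcFinish, receive_returned,
    Function.update_apply]

theorem Transition.rbcFinish_effect {ok : Fin n → Msg n → Prop} {s s' : NodeState n}
    (h : Transition n t i ok s s') {j : Fin n} (hs : s'.rbcFinish j = true) :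
    s.rbcFinish j = true ∨ n - t ≤ s.tally (.rbcReady j) := by
  cases h with
  | rbcFinish k hr h =>
    simp only [send, Function.update_apply] at hs
    grind
  | _ => grind [send, startBiased, inputAgree, beginRound, leaveRound, receive_sent,
    receive_finish, receive_record, receive_rbcReady, receive_rbcFinish, receive_returned,
    Function.update_apply]

theorem Transition.record_effect {ok : Fin n → Msg n → Prop} {s s' : NodeState n}
    (h : Transition n t i ok s s') {j : Fin n} {b : Bool} (hs : s'.record j = some b) :
    s.record j = some b ∨ n - t ≤ s.tally (.finish j b) := by
  cases h <;> grind [send, startBiased, inputAgree, beginRound, leaveRound, receive_sent,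
    receive_finish, receive_record, receive_rbcReady, receive_rbcFinish, receive_returned,
    Function.update_apply]

theorem Transition.count_effect {ok : Fin n → Msg n → Prop} {s s' : NodeState n}
    (h : Transition n t i ok s s') (hc : s.count = (nonmissing s.record).card) :
    s'.count = (nonmissing s'.record).card := by
  have := @card_nonmissing_update n s.record
  cases h <;> grind [send, startBiased, inputAgree, beginRound, leaveRound, receive_sent,
    receive_finish, receive_record, receive_rbcReady, receive_rbcFinish, receive_returned,
    Function.update_apply]

/-- Only missing entries are recorded, so the counter equals the number of entries set, and the
vector broadcast when it hits `n - t` has exactly that many. -/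
theorem Transition.rbcIn_effect {ok : Fin n → Msg n → Prop} {s s' : NodeState n}
    (h : Transition n t i ok s s') (hc : s.count = (nonmissing s.record).card)
    {w : Vec n} (hs : s'.rbcIn = some w) :
    s.rbcIn = some w ∨ ((nonmissing w).card = n - t ∧ w = s'.record) := by
  have := @card_nonmissing_update n s.record
  cases h <;> grind [send, startBiased, inputAgree, beginRound, leaveRound, receive_sent,
    receive_finish, receive_record, receive_rbcReady, receive_rbcFinish, receive_returned,
    Function.update_apply]

/-- The counter grows by one at a time, so it cannot jump over the value `n - t` that triggers the
broadcast. -/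
theorem Transition.rbcIn_isSome_effect {ok : Fin n → Msg n → Prop} {s s' : NodeState n}
    (h : Transition n t i ok s s') (hc : s.count < n - t) (hs : n - t ≤ s'.count) :
    s'.rbcIn.isSome := by
  cases h <;> grind [send, startBiased, inputAgree, beginRound, leaveRound, receive_sent,
    receive_finish, receive_record, receive_rbcReady, receive_rbcFinish, receive_returned,
    Function.update_apply]

/-! ### Invariants of the dispersal -/

/-- Invariants of the dispersal sub-protocol at node `i`. -/
structure DispersalInv (n t : ℕ) (i : Fin n) (s : NodeState n) : Prop where
  sent_ready : ∀ j b, .ready j b ∈ s.sent → s.ready b j = true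
  sent_finish : ∀ j b, .finish j b ∈ s.sent → s.finish b j = true
  sent_rbcReady : ∀ j, .rbcReady j ∈ s.sent → s.rbcReady j = true
  sent_rbcFinish : ∀ j, .rbcFinish j ∈ s.sent → s.rbcFinish j = true
  sent_election : .election ∈ s.sent → n - t ≤ s.tally (.rbcFinish i)
  sent_confirm : .confirm ∈ s.sent → n - t ≤ s.tally .election ∨ t + 1 ≤ s.tally .confirm
  returned : s.returned = true → .confirm ∈ s.sent ∧ 2 * t + 1 ≤ s.tally .confirm
  finish : ∀ j b, s.finish b j = true → n - t ≤ s.tally (.ready j b)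
  rbcReady : ∀ j, s.rbcReady j = true → (s.rbcOut j).isSome
  rbcFinish : ∀ j, s.rbcFinish j = true → n - t ≤ s.tally (.rbcReady j)
  record : ∀ j b, s.record j = some b → n - t ≤ s.tally (.finish j b)
  count : s.count = (nonmissing s.record).card
  rbcIn : ∀ w, s.rbcIn = some w → (nonmissing w).card = n - t ∧
    ∀ j b, w j = some b → s.record j = some b
  rbcIn_isSome : n - t ≤ s.count → (s.rbcIn).isSome

/-- Positivity of `n - t` matters: with threshold `0` the initial counter would already demand a
broadcast input. -/
theorem DispersalInv.init (ht : 0 < n - t) : DispersalInv n t i (NodeState.init n) := by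
  constructor <;> simp [NodeState.init, nonmissing]
  omega

theorem DispersalInv.step {ok : Fin n → Msg n → Prop} {s s' : NodeState n}
    (h : Transition n t i ok s s') (H : DispersalInv n t i s) : DispersalInv n t i s' := by
  have E := h.extends
  have T := E.tally
  have hsome : ∀ j, (s.rbcOut j).isSome → (s'.rbcOut j).isSome := fun j hj => by
    obtain ⟨w, hw⟩ := Option.isSome_iff_exists.1 hj
    simp [E.rbcOut j w hw]
  have C {m : Msg n} (hm : m ∈ s'.sent) := h.cause hm
  constructor
  · exact fun j b hm => (C hm).elim (fun h => E.ready _ _ (H.sent_ready j b h)) id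
  · exact fun j b hm => (C hm).elim (fun h => E.finish _ _ (H.sent_finish j b h)) id
  · exact fun j hm => (C hm).elim (fun h => E.rbcReady _ (H.sent_rbcReady j h)) id
  · exact fun j hm => (C hm).elim (fun h => E.rbcFinish _ (H.sent_rbcFinish j h)) id
  · exact fun hm => (C hm).elim (fun h => (H.sent_election h).trans (T _)) id
  · exact fun hm => (C hm).elim (fun h => (H.sent_confirm h).imp (·.trans (T _)) (·.trans (T _))) id
  · intro hs
    rcases h.returned_effect hs with h1 | ⟨h1, h2⟩
    · exact ⟨E.sent (H.returned h1).1, (H.returned h1).2.trans (T _)⟩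
    · exact ⟨h1, h2.trans (T _)⟩
  · exact fun j b hs => ((h.finish_effect hs).elim (H.finish j b) id).trans (T _)
  · exact fun j hs => hsome j ((h.rbcReady_effect hs).elim (H.rbcReady j) id)
  · exact fun j hs => ((h.rbcFinish_effect hs).elim (H.rbcFinish j) id).trans (T _)
  · exact fun j b hs => ((h.record_effect hs).elim (H.record j b) id).trans (T _)
  · exact h.count_effect H.count
  · intro w hw
    rcases h.rbcIn_effect H.count hw with h1 | ⟨h1, h2⟩
    · exact ⟨(H.rbcIn w h1).1, fun j b hj => E.record j b ((H.rbcIn w h1).2 j b hj)⟩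
    · exact ⟨h1, fun j b hj => h2 ▸ hj⟩
  · intro hs
    by_cases hc : n - t ≤ s.count
    · exact E.rbcIn (H.rbcIn_isSome hc)
    · exact h.rbcIn_isSome_effect (not_le.1 hc) hs

/-! ### Invariants of the biased agreements -/

/-- Invariants of the biased agreements. -/
structure BiasedInv (n t : ℕ) (s : NodeState n) : Prop where
  sent_value : ∀ id a b, .value id a b ∈ s.sent → s.biasedIn id = some (a, b)
  value_sent : ∀ id a b, s.biasedIn id = some (a, b) → .value id a b ∈ s.sent
  values : ∀ id p a b, s.values id p = some (a, b) → (p, .value id a b) ∈ s.received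
  values_isSome : ∀ id p a b, (p, .value id a b) ∈ s.received → (s.values id p).isSome
  phase : s.phase ≠ .dispersal → s.returned = true
  broadcast : ∀ l v, s.biasedIn (l, none) = some v → s.returned = true ∧
    v = (s.rbcReady l, s.rbcFinish l)
  vector : ∀ l j v, s.biasedIn (l, some j) = some v → s.returned = true ∧
    ∃ w c, s.rbcOut l = some w ∧ w j = some c ∧ v = (s.ready c j, s.finish c j)
  out_in : ∀ id, (s.biasedOut id).isSome → (s.biasedIn id).isSome
  out_of_in : ∀ id a b, s.biasedIn id = some (a, b) → (a || b) = true → (s.biasedOut id).isSome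
  out_true : ∀ id, s.biasedOut id = some true →
    (∃ a b, s.biasedIn id = some (a, b) ∧ (a || b) = true) ∨
    t + 1 ≤ s.valueTally id (fun v => v.1) ∨ t + 1 ≤ s.valueTally id (fun v => v.2)
  out_false : ∀ id, s.biasedOut id = some false → n - t ≤ s.valueTally id (fun v => !v.2)

theorem startBiased_biasedIn {s : NodeState n} {c : BiasedId n → Option (Bool × Bool)}
    {id : BiasedId n} {v : Bool × Bool} (h : (s.startBiased c).biasedIn id = some v) :
    s.biasedIn id = some v ∨ s.biasedIn id = none ∧ c id = some v := by
  cases hi : s.biasedIn id <;> cases hc : c id <;> simp_all [startBiased]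

theorem startBiased_sent {s : NodeState n} {c : BiasedId n → Option (Bool × Bool)}
    {id : BiasedId n} {a b : Bool} (h : (s.startBiased c).biasedIn id = some (a, b)) :
    s.biasedIn id = some (a, b) ∨ .value id a b ∈ (s.startBiased c).sent := by
  refine (startBiased_biasedIn h).imp_right fun ⟨hn, hc⟩ => ?_
  simp only [startBiased, Finset.mem_union, Finset.mem_biUnion, Finset.mem_univ, true_and]
  exact .inr ⟨id, by simp [hn, hc]⟩

theorem startBiased_biasedOut {s : NodeState n} {c : BiasedId n → Option (Bool × Bool)}
    {id : BiasedId n} {v : Bool} (h : (s.startBiased c).biasedOut id = some v) :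
    s.biasedOut id = some v ∨ v = true ∧ ∃ a b, (s.startBiased c).biasedIn id = some (a, b) ∧
      (a || b) = true := by
  cases hi : s.biasedIn id <;> rcases hc : c id with _ | ⟨a, b⟩ <;>
    simp only [startBiased, hi, hc] at h ⊢ <;> try exact .inl (by simpa using h)
  cases a <;> cases b <;> simp_all

theorem startBiased_out_of_in {s : NodeState n} {c : BiasedId n → Option (Bool × Bool)}
    {id : BiasedId n} {a b : Bool} (h : (s.startBiased c).biasedIn id = some (a, b))
    (hab : (a || b) = true) :
    s.biasedIn id = some (a, b) ∨ ((s.startBiased c).biasedOut id).isSome := by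
  refine (startBiased_biasedIn h).imp_right fun ⟨hn, hc⟩ => ?_
  simp [startBiased, hn, hc, hab, -Bool.or_eq_true]

theorem leaveRound_biased (s : NodeState n) (r : Fin n) :
    (s.leaveRound r).biasedIn = s.biasedIn ∧ (s.leaveRound r).biasedOut = s.biasedOut ∧
    (s.leaveRound r).values = s.values ∧ (s.leaveRound r).received = s.received := by
  unfold leaveRound beginRound
  split_ifs <;> exact ⟨rfl, rfl, rfl, rfl⟩

/-- Inputs appear only through `startBiased`, on leaving `electing` or `waiting`. The same step
sends the VALUE message and gives the immediate output, so there is no intermediate state in which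
input, message and output disagree. -/
theorem Transition.biasedIn_effect {ok : Fin n → Msg n → Prop} {s s' : NodeState n}
    (h : Transition n t i ok s s') {id : BiasedId n} {a b : Bool}
    (hs : s'.biasedIn id = some (a, b)) :
    s.biasedIn id = some (a, b) ∨ s.phase ≠ .dispersal ∧ .value id a b ∈ s'.sent ∧
      ((a || b) = true → (s'.biasedOut id).isSome) ∧
      ((∃ l, id = (l, none) ∧ (a, b) = (s.rbcReady l, s.rbcFinish l)) ∨
        ∃ l w j c, id = (l, some j) ∧ s.rbcOut l = some w ∧ w j = some c ∧
          (a, b) = (s.ready c j, s.finish c j)) := by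
  cases h with
  | elect r l hp h =>
    set c : BiasedId n → Option (Bool × Bool) := fun id =>
      if id = (l, none) then some (s.rbcReady l, s.rbcFinish l) else none with hc
    change (s.startBiased c).biasedIn id = some (a, b) at hs
    rcases startBiased_biasedIn hs with h1 | ⟨h1, h2⟩
    · exact .inl h1
    · have h3 := (startBiased_sent hs).resolve_left (by simp [h1])
      have h4 := fun hab => (startBiased_out_of_in hs hab).resolve_left (by simp [h1])
      refine .inr ⟨by simp [hp], h3, h4, .inl ⟨l, ?_⟩⟩
      simp only [hc] at h2
      split_ifs at h2 with h5
      exact ⟨h5, (Option.some_inj.1 h2).symm⟩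
  | examine r l w hp h hw =>
    change (s.startBiased (vectorCalls s l w)).biasedIn id = some (a, b) at hs
    rcases startBiased_biasedIn hs with h1 | ⟨h1, h2⟩
    · exact .inl h1
    · have h3 := (startBiased_sent hs).resolve_left (by simp [h1])
      have h4 := fun hab => (startBiased_out_of_in hs hab).resolve_left (by simp [h1])
      refine .inr ⟨by simp [hp], h3, h4, .inr ?_⟩
      obtain ⟨l', _ | j⟩ := id
      · simp [vectorCalls] at h2
      · simp only [vectorCalls] at h2
        split_ifs at h2 with h5
        subst h5
        obtain ⟨d, hd, he⟩ := Option.map_eq_some_iff.1 h2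
        exact ⟨l', w, j, d, rfl, h, hd, he.symm⟩
  | leave r l h =>
    rw [(leaveRound_biased s r).1] at hs
    exact .inl hs
  | _ => exact .inl hs

theorem Transition.biasedOut_effect {ok : Fin n → Msg n → Prop} {s s' : NodeState n}
    (h : Transition n t i ok s s') {id : BiasedId n} {v : Bool} (hs : s'.biasedOut id = some v) :
    s.biasedOut id = some v ∨
      v = true ∧ ((∃ a b, s'.biasedIn id = some (a, b) ∧ (a || b) = true) ∨
        (s.biasedIn id).isSome ∧ (t + 1 ≤ s.valueTally id (fun v => v.1) ∨
          t + 1 ≤ s.valueTally id (fun v => v.2))) ∨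
      v = false ∧ (s.biasedIn id).isSome ∧ n - t ≤ s.valueTally id (fun v => !v.2) := by
  cases h with
  | elect r l hp h =>
    exact (startBiased_biasedOut (s := s) (c := fun id =>
      if id = (l, none) then some (s.rbcReady l, s.rbcFinish l) else none) hs).imp_right
        fun ⟨h1, h2⟩ => .inl ⟨h1, .inl h2⟩
  | examine r l w hp h hw =>
    exact (startBiased_biasedOut (s := s) (c := vectorCalls s l w) hs).imp_right
        fun ⟨h1, h2⟩ => .inl ⟨h1, .inl h2⟩
  | biasedTrue id' hi ho h =>
    rcases setOnce_eq_some.1 hs with h1 | ⟨-, rfl, rfl⟩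
    · exact .inl h1
    · exact .inr (.inl ⟨rfl, .inr ⟨hi, h⟩⟩)
  | biasedFalse id' hi ho h =>
    rcases setOnce_eq_some.1 hs with h1 | ⟨-, rfl, rfl⟩
    · exact .inl h1
    · exact .inr (.inr ⟨rfl, hi, h⟩)
  | leave r l h =>
    rw [(leaveRound_biased s r).2.1] at hs
    exact .inl hs
  | _ => exact .inl hs

theorem receive_values_eq_some {s : NodeState n} {p q : Fin n} {m : Msg n} {id : BiasedId n}
    {a b : Bool} (h : (s.receive p m).values id q = some (a, b)) :
    s.values id q = some (a, b) ∨ q = p ∧ m = .value id a b := by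
  unfold receive at h
  cases m with
  | value id' a' b' =>
    simp only at h
    split_ifs at h with hid
    · subst hid
      rcases setOnce_eq_some.1 h with h | ⟨-, rfl, h⟩
      · exact .inl h
      · exact .inr ⟨rfl, by simp_all⟩
    · exact .inl h
  | _ => exact .inl h

theorem receive_values_self (s : NodeState n) (p : Fin n) (id : BiasedId n) (a b : Bool) :
    ((s.receive p (.value id a b)).values id p).isSome := by
  simp only [receive, if_true]
  exact isSome_setOnce_self _ _ _

theorem Transition.values_effect {ok : Fin n → Msg n → Prop} {s s' : NodeState n}
    (h : Transition n t i ok s s') {id : BiasedId n} {p : Fin n} {a b : Bool}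
    (hs : s'.values id p = some (a, b)) :
    s.values id p = some (a, b) ∨ (p, .value id a b) ∈ s'.received := by
  cases h with
  | deliver q m h =>
    rcases receive_values_eq_some hs with h | ⟨rfl, rfl⟩
    · exact .inl h
    · exact .inr (Finset.mem_insert_self _ _)
  | leave r l h =>
    rw [(leaveRound_biased s r).2.2.1] at hs
    exact .inl hs
  | _ => exact .inl hs

theorem Transition.received_effect {ok : Fin n → Msg n → Prop} {s s' : NodeState n}
    (h : Transition n t i ok s s') {p : Fin n} {m : Msg n} (hs : (p, m) ∈ s'.received) :
    (p, m) ∈ s.received ∨ ok p m ∧ s' = s.receive p m := by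
  cases h with
  | deliver q m' h =>
    rcases Finset.mem_insert.1 hs with h' | h'
    · cases h'
      exact .inr ⟨h, rfl⟩
    · exact .inl h'
  | leave r l h =>
    rw [(leaveRound_biased s r).2.2.2] at hs
    exact .inl hs
  | _ => exact .inl hs

/-- The phase changes only by a step of the main loop, which is possible only after the dispersal
has returned. -/
theorem Transition.phase_effect {ok : Fin n → Msg n → Prop} {s s' : NodeState n}
    (h : Transition n t i ok s s') :
    s'.phase = s.phase ∨ s.returned = true ∨ s.phase ≠ .dispersal := by
  cases h with
  | start h hp hr => exact .inr (.inl hr)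
  | leave r l h =>
    refine .inr (.inr ?_)
    rcases h with ⟨h, -⟩ | ⟨w, h, -⟩ | ⟨w, h, -⟩ <;> simp [h]
  | elect | propose | await | examine | judge | terminate => exact .inr (.inr (by simp [*]))
  | _ => exact .inl rfl

theorem BiasedInv.init : BiasedInv n t (NodeState.init n) := by
  constructor <;> simp [NodeState.init]

theorem BiasedInv.step {ok : Fin n → Msg n → Prop} {s s' : NodeState n}
    (h : Transition n t i ok s s') (H : BiasedInv n t s) : BiasedInv n t s' := by
  have E := h.extends
  have V := E.valueTally
  have I {id} (hi : (s.biasedIn id).isSome) : (s'.biasedIn id).isSome := by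
    obtain ⟨v, hv⟩ := Option.isSome_iff_exists.1 hi
    simp [E.biasedIn id v hv]
  constructor
  · intro id a b hm
    exact (h.cause hm).elim (fun h => E.biasedIn _ _ (H.sent_value id a b h)) fun h => h
  · intro id a b hi
    rcases h.biasedIn_effect hi with h1 | h1
    · exact E.sent (H.value_sent id a b h1)
    · exact h1.2.1
  · intro id p a b hv
    exact (h.values_effect hv).elim (fun h => E.received (H.values id p a b h)) fun h => h
  · intro id p a b hm
    rcases h.received_effect hm with h1 | ⟨-, rfl⟩
    · obtain ⟨v, hv⟩ := Option.isSome_iff_exists.1 (H.values_isSome id p a b h1)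
      simp [E.values id p v hv]
    · exact receive_values_self _ _ _ _ _
  · intro hp
    rcases h.phase_effect with h1 | h1 | h1
    · exact (E.returned (H.phase (h1 ▸ hp))).1
    · exact (E.returned h1).1
    · exact (E.returned (H.phase h1)).1
  · rintro l ⟨a, b⟩ hi
    rcases h.biasedIn_effect hi with h1 | ⟨h1, -, -, h2⟩
    · obtain ⟨hr, hv⟩ := H.broadcast l _ h1
      -- The node has returned, so its indicators are frozen and the pair read earlier still equals
      -- them.
      obtain ⟨k1, k2, k3, k4, k5⟩ := E.returned hr
      exact ⟨k1, by rw [k4, k5]; exact hv⟩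
    · obtain ⟨k1, k2, k3, k4, k5⟩ := E.returned (H.phase h1)
      rcases h2 with ⟨l', e, hv⟩ | ⟨l', w, j, c, e, -⟩
      · cases e
        exact ⟨k1, by rw [k4, k5]; exact hv⟩
      · simp at e
  · rintro l j ⟨a, b⟩ hi
    rcases h.biasedIn_effect hi with h1 | ⟨h1, -, -, h2⟩
    · obtain ⟨hr, w, c, hw, hc, hv⟩ := H.vector l j _ h1
      obtain ⟨k1, k2, k3, k4, k5⟩ := E.returned hr
      exact ⟨k1, w, c, E.rbcOut _ _ hw, hc, by rw [k2, k3]; exact hv⟩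
    · obtain ⟨k1, k2, k3, k4, k5⟩ := E.returned (H.phase h1)
      rcases h2 with ⟨l', e, hv⟩ | ⟨l', w, j', c, e, hw, hc, hv⟩
      · simp at e
      · cases e
        exact ⟨k1, w, c, E.rbcOut _ _ hw, hc, by rw [k2, k3]; exact hv⟩
  · intro id ho
    obtain ⟨v, hv⟩ := Option.isSome_iff_exists.1 ho
    rcases h.biasedOut_effect hv with h1 | ⟨-, ⟨a, b, h1, -⟩ | ⟨h1, -⟩⟩ | ⟨-, h1, -⟩
    · exact I (H.out_in id (by simp [h1]))
    · simp [h1]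
    · exact I h1
    · exact I h1
  · intro id a b hi hab
    rcases h.biasedIn_effect hi with h1 | ⟨-, -, h1, -⟩
    · exact E.biasedOut id (H.out_of_in id a b h1 hab)
    · exact h1 hab
  · intro id ho
    rcases h.biasedOut_effect ho with h1 | ⟨-, h1 | ⟨-, h1⟩⟩ | ⟨h1, -⟩
    · exact (H.out_true id h1).imp (fun ⟨a, b, h, hab⟩ => ⟨a, b, E.biasedIn _ _ h, hab⟩)
        (Or.imp (·.trans (V _ _)) (·.trans (V _ _)))
    · exact .inl h1
    · exact .inr (h1.imp (·.trans (V _ _)) (·.trans (V _ _)))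
    · simp at h1
  · intro id ho
    rcases h.biasedOut_effect ho with h1 | ⟨h1, -⟩ | ⟨-, -, h1⟩
    · exact (H.out_false id h1).trans (V _ _)
    · simp at h1
    · exact h1.trans (V _ _)

/-! ### Invariants of the main loop -/

/-- What is known about a node whose main loop is at the given control point. -/
def PhaseInv (n t : ℕ) (s : NodeState n) : Phase n → Prop
  | .dispersal => True
  | .electing r => s.coinOn r = true
  | .biased r l => s.coinOn r = true ∧ s.coinOut r = some l ∧ (s.biasedIn (l, none)).isSome
  | .agreeing r l => s.coinOn r = true ∧ s.coinOut r = some l ∧ (s.agreeIn (l, .broadcast)).isSome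
  | .waiting r l => s.coinOn r = true ∧ s.coinOut r = some l ∧
      s.agreeOut (l, .broadcast) = some true
  | .checking r l w => s.coinOn r = true ∧ s.coinOut r = some l ∧
      s.agreeOut (l, .broadcast) = some true ∧ s.rbcOut l = some w ∧
      n - t ≤ (nonmissing w).card ∧ ∀ j ∈ nonmissing w, (s.biasedIn (l, some j)).isSome
  | .deciding r l w => s.coinOn r = true ∧ s.coinOut r = some l ∧
      s.agreeOut (l, .broadcast) = some true ∧ s.rbcOut l = some w ∧
      n - t ≤ (nonmissing w).card ∧ (s.agreeIn (l, .vector)).isSome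
  | .terminated _ => True
  | .exhausted => True

/-- Invariants of the main loop. -/
structure LoopInv (n t : ℕ) (s : NodeState n) : Prop where
  coinOn : ∀ r, s.coinOn r = true → s.returned = true ∧ ∀ r' < r, s.Passed t r'
  coinOut : ∀ r l, s.coinOut r = some l → s.coinOn r = true
  agree_broadcast : ∀ l v, s.agreeIn (l, .broadcast) = some v → s.biasedOut (l, none) = some v
  agree_vector : ∀ l, s.agreeIn (l, .vector) = some false → ∃ w, s.rbcOut l = some w ∧
    ∃ j ∈ nonmissing w, s.biasedOut (l, some j) = some false
  phase : PhaseInv n t s s.phase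

theorem Extends.biasedIn_isSome {s s' : NodeState n} (h : Extends s s') {id : BiasedId n}
    (hi : (s.biasedIn id).isSome) : (s'.biasedIn id).isSome := by
  obtain ⟨v, hv⟩ := Option.isSome_iff_exists.1 hi
  simp [h.biasedIn id v hv]

theorem Extends.agreeIn_isSome {s s' : NodeState n} (h : Extends s s') {id : AgreeId n}
    (hi : (s.agreeIn id).isSome) : (s'.agreeIn id).isSome := by
  obtain ⟨v, hv⟩ := Option.isSome_iff_exists.1 hi
  simp [h.agreeIn id v hv]

theorem PhaseInv.mono {s s' : NodeState n} (h : Extends s s') {p : Phase n}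
    (H : PhaseInv n t s p) : PhaseInv n t s' p := by
  cases p with
  | dispersal | terminated | exhausted => trivial
  | electing r => exact h.coinOn r H
  | biased r l =>
    exact ⟨h.coinOn _ H.1, h.coinOut _ _ H.2.1, h.biasedIn_isSome H.2.2⟩
  | agreeing r l =>
    exact ⟨h.coinOn _ H.1, h.coinOut _ _ H.2.1, h.agreeIn_isSome H.2.2⟩
  | waiting r l => exact ⟨h.coinOn _ H.1, h.coinOut _ _ H.2.1, h.agreeOut _ _ H.2.2⟩
  | checking r l w =>
    obtain ⟨h1, h2, h3, h4, h5, h6⟩ := H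
    exact ⟨h.coinOn _ h1, h.coinOut _ _ h2, h.agreeOut _ _ h3, h.rbcOut _ _ h4, h5,
      fun j hj => h.biasedIn_isSome (h6 j hj)⟩
  | deciding r l w =>
    obtain ⟨h1, h2, h3, h4, h5, h6⟩ := H
    exact ⟨h.coinOn _ h1, h.coinOut _ _ h2, h.agreeOut _ _ h3, h.rbcOut _ _ h4, h5,
      h.agreeIn_isSome h6⟩

theorem NodeState.Leaves.passed {s : NodeState n} {r l : Fin n} (h : s.Leaves t r l)
    (H : PhaseInv n t s s.phase) : s.coinOn r = true ∧ s.Passed t r := by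
  rcases h with ⟨hp, ha⟩ | ⟨w, hp, hw, hc⟩ | ⟨w, hp, ha⟩ <;> rw [hp] at H
  · exact ⟨H.1, l, H.2.1, .inl ha⟩
  · exact ⟨H.1, l, H.2.1, .inr ⟨H.2.2, w, hw, .inl hc⟩⟩
  · obtain ⟨h1, h2, h3, h4, h5, h6⟩ := H
    exact ⟨h1, l, h2, .inr ⟨h3, w, h4, .inr ⟨ha, h5⟩⟩⟩

theorem leaveRound_loop (s : NodeState n) (r : Fin n) :
    (s.leaveRound r).agreeIn = s.agreeIn ∧ (s.leaveRound r).coinOut = s.coinOut := by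
  unfold leaveRound beginRound
  split_ifs <;> exact ⟨rfl, rfl⟩

/-- A coin is activated exactly on entering its round, and a round is entered either at the start or
by leaving its predecessor. -/
theorem Transition.coinOn_effect {ok : Fin n → Msg n → Prop} {s s' : NodeState n}
    (h : Transition n t i ok s s') {r : Fin n} (hr : s'.coinOn r = true) :
    s.coinOn r = true ∨ s'.phase = .electing r ∧
      ((s.returned = true ∧ r.1 = 0) ∨ ∃ r' l, r'.1 + 1 = r.1 ∧ s.Leaves t r' l) := by
  cases h with
  | start h0 hp h =>
    simp only [beginRound, Function.update_apply] at hr ⊢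
    split_ifs at hr with e
    · exact .inr ⟨by rw [e], .inl ⟨h, by simp [e]⟩⟩
    · exact .inl hr
  | leave r' l h =>
    unfold leaveRound at hr ⊢
    split_ifs at hr ⊢ with hn
    · simp only [beginRound, Function.update_apply] at hr ⊢
      split_ifs at hr with e
      · exact .inr ⟨by rw [e], .inr ⟨r', l, by simp [e], h⟩⟩
      · exact .inl hr
    · exact .inl hr
  | _ => exact .inl hr

theorem Transition.coinOut_effect {ok : Fin n → Msg n → Prop} {s s' : NodeState n}
    (h : Transition n t i ok s s') {r l : Fin n} (hr : s'.coinOut r = some l) :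
    s.coinOut r = some l ∨ s.coinOn r = true := by
  cases h with
  | coin r' l' h =>
    rcases setOnce_eq_some.1 hr with h1 | ⟨-, rfl, -⟩
    · exact .inl h1
    · exact .inr h
  | leave r' l h =>
    rw [(leaveRound_loop s r').2] at hr
    exact .inl hr
  | _ => exact .inl hr

theorem Transition.agreeIn_effect {ok : Fin n → Msg n → Prop} {s s' : NodeState n}
    (h : Transition n t i ok s s') {id : AgreeId n} {v : Bool} (hr : s'.agreeIn id = some v) :
    s.agreeIn id = some v ∨
      (∃ l, id = (l, .broadcast) ∧ s.biasedOut (l, none) = some v) ∨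
      ∃ r l w, id = (l, .vector) ∧ s.phase = .checking r l w ∧
        (∀ j ∈ nonmissing w, (s.biasedOut (l, some j)).isSome) ∧
        v = decide (∀ j ∈ nonmissing w, s.biasedOut (l, some j) = some true) := by
  cases h with
  | propose r l v hp h =>
    rcases setOnce_eq_some.1 hr with h1 | ⟨-, rfl, rfl⟩
    · exact .inl h1
    · exact .inr (.inl ⟨l, rfl, h⟩)
  | judge r l w hp h =>
    rcases setOnce_eq_some.1 hr with h1 | ⟨-, rfl, rfl⟩
    · exact .inl h1
    · exact .inr (.inr ⟨r, l, w, rfl, hp, h, rfl⟩)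
  | leave r' l h =>
    rw [(leaveRound_loop s r').1] at hr
    exact .inl hr
  | _ => exact .inl hr

theorem startBiased_isSome {s : NodeState n} {c : BiasedId n → Option (Bool × Bool)}
    {id : BiasedId n} (h : (c id).isSome) : ((s.startBiased c).biasedIn id).isSome := by
  cases hi : s.biasedIn id <;> cases hc : c id <;> simp_all [startBiased]

theorem Transition.phaseInv {ok : Fin n → Msg n → Prop} {s s' : NodeState n}
    (h : Transition n t i ok s s') (H : PhaseInv n t s s.phase) : PhaseInv n t s' s'.phase := by
  have E := h.extends
  have H' := H.mono E
  cases h with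
  | start h0 hp h => simp [PhaseInv, beginRound]
  | elect r l hp h =>
    rw [hp] at H'
    exact ⟨H', h, startBiased_isSome (s := s) (c := fun id =>
      if id = (l, none) then some (s.rbcReady l, s.rbcFinish l) else none) (by simp)⟩
  | propose r l v hp h =>
    rw [hp] at H'
    exact ⟨H'.1, H'.2.1, isSome_setOnce_self _ _ _⟩
  | await r l hp h =>
    rw [hp] at H'
    exact ⟨H'.1, H'.2.1, h⟩
  | examine r l w hp h hw =>
    rw [hp] at H'
    refine ⟨H'.1, H'.2.1, H'.2.2, h, hw, fun j hj =>
      startBiased_isSome (s := s) (c := vectorCalls s l w) ?_⟩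
    simpa [vectorCalls, nonmissing] using hj
  | judge r l w hp h =>
    rw [hp] at H'
    obtain ⟨h1, h2, h3, h4, h5, h6⟩ := H'
    exact ⟨h1, h2, h3, h4, h5, isSome_setOnce_self _ _ _⟩
  | terminate => trivial
  | leave r l h =>
    unfold leaveRound
    split_ifs
    · simp [PhaseInv, beginRound]
    · trivial
  | _ => exact H'

theorem LoopInv.init : LoopInv n t (NodeState.init n) := by
  constructor <;> simp [NodeState.init, PhaseInv]

theorem LoopInv.step {ok : Fin n → Msg n → Prop} {s s' : NodeState n}
    (h : Transition n t i ok s s') (B : BiasedInv n t s) (H : LoopInv n t s) :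
    LoopInv n t s' := by
  have E := h.extends
  constructor
  · intro r hr
    rcases h.coinOn_effect hr with h1 | ⟨-, ⟨h1, h2⟩ | ⟨r', l, h1, h2⟩⟩
    · exact ⟨(E.returned (H.coinOn r h1).1).1, fun r' hr' => E.passed ((H.coinOn r h1).2 r' hr')⟩
    · refine ⟨(E.returned h1).1, fun r' hr' => absurd hr' ?_⟩
      simp [Fin.lt_def, h2]
    · obtain ⟨h3, h4⟩ := h2.passed H.phase
      obtain ⟨h5, h6⟩ := H.coinOn r' h3
      refine ⟨(E.returned h5).1, fun q hq => E.passed ?_⟩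
      rcases (show q < r' ∨ q = r' by rw [Fin.lt_def, Fin.ext_iff]; omega) with h7 | rfl
      · exact h6 q h7
      · exact h4
  · intro r l hr
    exact E.coinOn r ((h.coinOut_effect hr).elim (H.coinOut r l) fun h => h)
  · intro l v hv
    have hb : s.biasedOut (l, none) = some v := by
      rcases h.agreeIn_effect hv with h1 | ⟨l', e, h1⟩ | ⟨r, l', w, e, -⟩
      · exact H.agree_broadcast l v h1
      · cases e; exact h1
      · cases e
    exact E.biasedOut_eq _ _ (B.out_in _ (by simp [hb])) hb
  · intro l hv
    have hb : ∃ w, s.rbcOut l = some w ∧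
        ∃ j ∈ nonmissing w, s.biasedOut (l, some j) = some false := by
      rcases h.agreeIn_effect hv with h1 | ⟨l', e, h1⟩ | ⟨r, l', w, e, hp, h1, h2⟩
      · exact H.agree_vector l h1
      · cases e
      · cases e
        have hP := H.phase
        rw [hp] at hP
        refine ⟨w, hP.2.2.2.1, ?_⟩
        -- All checks have an output, so an input `0` to the agreement on the vector points to a
        -- position whose check gave `0`.
        have h2 := of_decide_eq_false h2.symm
        push Not at h2
        obtain ⟨j, hj, hne⟩ := h2
        obtain ⟨v, hv⟩ := Option.isSome_iff_exists.1 (h1 j hj)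
        cases v
        · exact ⟨j, hj, hv⟩
        · exact absurd hv hne
    obtain ⟨w, hw, j, hj, hb⟩ := hb
    exact ⟨w, E.rbcOut _ _ hw, j, hj, E.biasedOut_eq _ _ (B.out_in _ (by simp [hb])) hb⟩
  · exact h.phaseInv H.phase

end APVA

/-! ### Executions: invariants over time and tracing of messages -/

namespace APVA

variable {n t : ℕ} {F : Finset (Fin n)}

open NodeState Filter

/-- Unlike the analysis by `Transition`, this keeps the fact that `mainStep` itself was executed,
which `main_progress` has to return. -/
theorem LocalStep.phase_effect {i : Fin n} {σ : Fin n → NodeState n} {s' : NodeState n}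
    (h : LocalStep n t F σ i s') : s'.phase = (σ i).phase ∨ mainStep n t (σ i) = some s' := by
  cases h with
  | handler a s h =>
    cases a with
    | main => exact .inr h
    | biased id =>
      simp only [Handler.run, biasedStep] at h
      split_ifs at h <;> cases h <;> exact .inl rfl
    | dispersal d =>
      simp only [Handler.run] at h
      split_ifs at h
      cases d with
      | vote j =>
        obtain ⟨b, -, rfl⟩ := Option.map_eq_some_iff.1 h
        exact .inl rfl
      | _ =>
        simp only [Dispersal.run] at h
        split_ifs at h
        all_goals cases h; exact .inl rfl
  | _ => exact .inl rfl

namespace Execution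

variable (E : Execution n t F)

theorem localStep (i : Fin n) (k : ℕ) :
    E.state (k + 1) i = E.state k i ∨ LocalStep n t F (E.state k) i (E.state (k + 1) i) := by
  rcases E.step k with h | ⟨i', hi', s, hs, h⟩
  · exact .inl (by rw [h])
  · by_cases e : i = i'
    · subst e
      rw [h, Function.update_self]
      exact .inr hs
    · exact .inl (by rw [h, Function.update_of_ne e])

theorem transition (i : Fin n) (k : ℕ) :
    E.state (k + 1) i = E.state k i ∨
      Transition n t i (fun p m => p ∈ F ∨ m ∈ (E.state k p).sent) (E.state k i)
        (E.state (k + 1) i) :=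
  (E.localStep i k).imp_right LocalStep.transition

theorem extends_of_le (i : Fin n) {k k' : ℕ} (h : k ≤ k') :
    Extends (E.state k i) (E.state k' i) := by
  induction k', h using Nat.le_induction with
  | base => exact .refl _
  | succ m _ ih =>
    rcases E.transition i m with h | h
    · rwa [h]
    · exact ih.trans h.extends

theorem inv (hn : 3 * t + 1 ≤ n) {i : Fin n} (hi : i ∉ F) (k : ℕ) :
    DispersalInv n t i (E.state k i) ∧ BiasedInv n t (E.state k i) ∧
      LoopInv n t (E.state k i) := by
  induction k with
  | zero =>
    rw [E.init i hi]
    exact ⟨.init (by omega), .init, .init⟩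
  | succ k ih =>
    rcases E.transition i k with h | h
    · rwa [h]
    · exact ⟨ih.1.step h, ih.2.1.step h, ih.2.2.step h ih.2.1⟩

/-- Two facts about a node, both persistent, hold together at some time. -/
theorem common (i : Fin n) (k k' : ℕ) : ∃ s : NodeState n, ∃ m, s = E.state m i ∧
    Extends (E.state k i) s ∧ Extends (E.state k' i) s :=
  ⟨_, max k k', rfl, E.extends_of_le i (le_max_left _ _), E.extends_of_le i (le_max_right _ _)⟩

/-- For persistent facts, "at some time" becomes "from some time on". Finitely many such facts can
then be intersected, and enabledness becomes permanent, as fairness requires. -/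
theorem eventually_of_exists (i : Fin n) {P : NodeState n → Prop}
    (hP : ∀ s s', Extends s s' → P s → P s') (h : ∃ k, P (E.state k i)) :
    ∀ᶠ k in atTop, P (E.state k i) := by
  obtain ⟨k, hk⟩ := h
  exact eventually_atTop.2 ⟨k, fun k' hk' => hP _ _ (E.extends_of_le i hk') hk⟩

/-- The sending time is strictly earlier, which makes descent along chains of messages well founded.
-/
theorem sent_of_received {i p : Fin n} (hi : i ∉ F) (hp : p ∉ F) {k : ℕ} {m : Msg n}
    (h : (p, m) ∈ (E.state k i).received) : ∃ k' < k, m ∈ (E.state k' p).sent := by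
  induction k with
  | zero => simp [E.init i hi, NodeState.init] at h
  | succ k ih =>
    have old (h : (p, m) ∈ (E.state k i).received) : ∃ k' < k + 1, m ∈ (E.state k' p).sent := by
      obtain ⟨k', hk', hm⟩ := ih h
      exact ⟨k', hk'.trans k.lt_succ_self, hm⟩
    rcases E.transition i k with e | e
    · exact old (e ▸ h)
    · rcases e.received_effect h with h | ⟨h, -⟩
      · exact old h
      · exact ⟨k, k.lt_succ_self, h.resolve_left hp⟩

theorem card_le_honest_add (hF : F.card ≤ t) (B : Finset (Fin n)) :
    B.card ≤ (B \ F).card + t := by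
  have := Finset.card_le_card_sdiff_add_card (s := B) (t := F)
  omega

/-- A tally counts distinct senders, at most `t` of them dishonest. The additive form avoids
truncated subtraction. -/
theorem honest_senders (hF : F.card ≤ t) {i : Fin n} (hi : i ∉ F) (k : ℕ) (m : Msg n) :
    ∃ A : Finset (Fin n), (E.state k i).tally m ≤ A.card + t ∧
      ∀ p ∈ A, p ∉ F ∧ ∃ k' < k, m ∈ (E.state k' p).sent := by
  refine ⟨_, card_le_honest_add hF _, fun p hp => ?_⟩
  simp only [Finset.mem_sdiff, Finset.mem_filter, Finset.mem_univ, true_and] at hp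
  exact ⟨hp.2, E.sent_of_received hi hp.2 hp.1⟩

theorem exists_honest_sender (hF : F.card ≤ t) {i : Fin n} (hi : i ∉ F) {k : ℕ} {m : Msg n}
    (h : t + 1 ≤ (E.state k i).tally m) : ∃ p ∉ F, ∃ k' < k, m ∈ (E.state k' p).sent := by
  obtain ⟨A, hA, hm⟩ := E.honest_senders hF hi k m
  obtain ⟨p, hp⟩ := Finset.card_pos.1 (show 0 < A.card by omega)
  exact ⟨p, hm p hp⟩

theorem exists_honest (hn : 3 * t + 1 ≤ n) (hF : F.card ≤ t) : ∃ i, i ∉ F := by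
  by_contra! h
  have := Finset.card_le_card (s := Finset.univ) (t := F) fun i _ => h i
  rw [Finset.card_univ, Fintype.card_fin] at this
  omega

theorem card_honest (hF : F.card ≤ t) : n - t ≤ Fᶜ.card := by
  rw [Finset.card_compl, Fintype.card_fin]
  omega

theorem biasedIn_of_values (hn : 3 * t + 1 ≤ n) {i p : Fin n} (hi : i ∉ F) (hp : p ∉ F) {k : ℕ}
    {id : BiasedId n} {a b : Bool} (h : (E.state k i).values id p = some (a, b)) :
    ∃ k, (E.state k p).biasedIn id = some (a, b) := by
  obtain ⟨k', -, hm⟩ := E.sent_of_received hi hp ((E.inv hn hi k).2.1.values _ _ _ _ h)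
  exact ⟨k', (E.inv hn hp k').2.1.sent_value _ _ _ hm⟩

theorem agreeOut_unique {p : Fin n} {k k' : ℕ} {id : AgreeId n} {v v' : Bool}
    (h : (E.state k p).agreeOut id = some v) (h' : (E.state k' p).agreeOut id = some v') :
    v = v' := by
  obtain ⟨s, -, -, e, e'⟩ := E.common p k k'
  exact Option.some_inj.1 ((e.agreeOut _ _ h).symm.trans (e'.agreeOut _ _ h'))

/-! ### What biased agreements can output -/

/-- The bits that a node inputs to the biased agreement on a broadcast are its final indicators. -/
theorem biasedIn_broadcast (hn : 3 * t + 1 ≤ n) {p l : Fin n} (hp : p ∉ F) {k : ℕ}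
    {v : Bool × Bool} (h : (E.state k p).biasedIn (l, none) = some v) (k' : ℕ) :
    ((E.state k' p).rbcReady l = true → v.1 = true) ∧
    ((E.state k' p).rbcFinish l = true → v.2 = true) := by
  obtain ⟨s, m, rfl, e, e'⟩ := E.common p k k'
  obtain ⟨-, hv⟩ := (E.inv hn hp m).2.1.broadcast l v (e.biasedIn _ _ h)
  rw [hv]
  exact ⟨e'.rbcReady l, e'.rbcFinish l⟩

/-- The bits that a node inputs to the biased agreement on a position of a vector are its final
indicators. -/
theorem biasedIn_vector (hn : 3 * t + 1 ≤ n) {p l j : Fin n} (hp : p ∉ F) {k : ℕ}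
    {v : Bool × Bool} (h : (E.state k p).biasedIn (l, some j) = some v)
    {q : Fin n} (hq : q ∉ F) {k₀ : ℕ} {w : Vec n} (hw : (E.state k₀ q).rbcOut l = some w)
    {c : Bool} (hc : w j = some c) (k' : ℕ) :
    ((E.state k' p).ready c j = true → v.1 = true) ∧
    ((E.state k' p).finish c j = true → v.2 = true) := by
  obtain ⟨s, m, rfl, e, e'⟩ := E.common p k k'
  obtain ⟨-, w', c', hw', hc', hv⟩ := (E.inv hn hp m).2.1.vector l j v (e.biasedIn _ _ h)
  obtain rfl := (E.rbc l).consistency q hq p hp w w' ⟨_, hw⟩ ⟨_, hw'⟩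
  obtain rfl := Option.some_inj.1 (hc.symm.trans hc')
  rw [hv]
  exact ⟨e'.ready _ j, e'.finish _ j⟩

/-- A biased agreement does not output `0` if `t + 1` honest nodes have second bit `1`. -/
theorem biasedOut_ne_false (hn : 3 * t + 1 ≤ n) {id : BiasedId n} {A : Finset (Fin n)}
    (hA : t + 1 ≤ A.card)
    (h : ∀ p ∈ A, p ∉ F ∧ ∀ k v, (E.state k p).biasedIn id = some v → v.2 = true)
    {i : Fin n} (hi : i ∉ F) (k : ℕ) : (E.state k i).biasedOut id ≠ some false := by
  intro ho
  -- Output `0` needs `n - t` senders of a second bit `0`. None lies in `A`, and `n - t` plus `t +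
  -- 1` exceeds `n`.
  have hB := (E.inv hn hi k).2.1.out_false id ho
  have hd : Disjoint A (Finset.univ.filter fun p =>
      ((E.state k i).values id p).any (fun v => !v.2) = true) := by
    rw [Finset.disjoint_left]
    intro p hp hv
    simp only [Finset.mem_filter, Finset.mem_univ, true_and, Option.any_eq_true] at hv
    obtain ⟨⟨a, b⟩, hv, hb⟩ := hv
    obtain ⟨k', hk'⟩ := E.biasedIn_of_values hn hi (h p hp).1 hv
    have := (h p hp).2 k' _ hk'
    simp_all
  have hc := Finset.card_le_univ (A ∪ (Finset.univ.filter fun p =>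
      ((E.state k i).values id p).any (fun v => !v.2) = true))
  rw [Finset.card_union_of_disjoint hd, Fintype.card_fin] at hc
  unfold valueTally at hB
  omega

/-- The dispersal of the honest node `l` is completed at some time. -/
def Good (l : Fin n) : Prop := l ∉ F ∧ ∃ k, .election ∈ (E.state k l).sent

variable {E}

/-- ELECTION is sent only after `n - t` FINISH messages about the broadcast of `l`. At least `n - 2
* t ≥ t + 1` of them are honest, and their senders enter the biased agreement with second bit `1`.
-/
theorem Good.biasedOut_broadcast (hn : 3 * t + 1 ≤ n) (hF : F.card ≤ t) {l : Fin n}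
    (hl : E.Good l) {i : Fin n} (hi : i ∉ F) (k : ℕ) :
    (E.state k i).biasedOut (l, none) ≠ some false := by
  obtain ⟨hlF, k₀, hk₀⟩ := hl
  have hc := (E.inv hn hlF k₀).1.sent_election hk₀
  obtain ⟨A, hA, hm⟩ := E.honest_senders hF hlF k₀ (.rbcFinish l)
  refine E.biasedOut_ne_false hn (A := A) (by omega) (fun p hp => ⟨(hm p hp).1, ?_⟩) hi k
  obtain ⟨hpF, k', -, hs⟩ := hm p hp
  exact fun k v hv => (E.biasedIn_broadcast hn hpF hv k').2
    ((E.inv hn hpF k').1.sent_rbcFinish l hs)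

/-- Integrity makes any delivered vector one that the honest leader really broadcast, a snapshot of
its record, and each recorded entry rests on a FINISH quorum. -/
theorem Good.exists_record (hn : 3 * t + 1 ≤ n) {l : Fin n}
    (hl : E.Good l) {i : Fin n} (hi : i ∉ F) {k : ℕ} {w : Vec n}
    (hw : (E.state k i).rbcOut l = some w) : (nonmissing w).card = n - t ∧
      ∃ k', ∀ j b, w j = some b → n - t ≤ (E.state k' l).tally (.finish j b) := by
  obtain ⟨k', hk'⟩ := (E.rbc l).integrity hl.1 i hi w ⟨k, hw⟩
  have hI := (E.inv hn hl.1 k').1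
  exact ⟨(hI.rbcIn w hk').1, k', fun j b hj => hI.record j b ((hI.rbcIn w hk').2 j b hj)⟩

theorem Good.biasedOut_vector (hn : 3 * t + 1 ≤ n) (hF : F.card ≤ t) {l : Fin n}
    (hl : E.Good l) {q : Fin n} (hq : q ∉ F) {k₀ : ℕ} {w : Vec n}
    (hw : (E.state k₀ q).rbcOut l = some w) {j : Fin n} (hj : j ∈ nonmissing w)
    {i : Fin n} (hi : i ∉ F) (k : ℕ) : (E.state k i).biasedOut (l, some j) ≠ some false := by
  obtain ⟨-, k', hk'⟩ := hl.exists_record hn hq hw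
  simp only [nonmissing, Finset.mem_filter, Finset.mem_univ, true_and] at hj
  obtain ⟨b, hb⟩ := Option.isSome_iff_exists.1 hj
  have hc := hk' j b hb
  obtain ⟨A, hA, hm⟩ := E.honest_senders hF hl.1 k' (.finish j b)
  refine E.biasedOut_ne_false hn (A := A) (by omega) (fun p hp => ⟨(hm p hp).1, ?_⟩) hi k
  obtain ⟨hpF, k'', -, hs⟩ := hm p hp
  exact fun k v hv => (E.biasedIn_vector hn hpF hv hq hw hb k'').2
    ((E.inv hn hpF k'').1.sent_finish j b hs)

variable (E)

/-- The first bit certifies an output at `p` itself. The second certifies a READY quorum, which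
contains an honest sender whose own broadcast output is known. -/
theorem exists_rbcOut_of_biasedIn (hn : 3 * t + 1 ≤ n) (hF : F.card ≤ t) {p l : Fin n}
    (hp : p ∉ F) {k : ℕ} {a b : Bool} (h : (E.state k p).biasedIn (l, none) = some (a, b))
    (hab : (a || b) = true) : ∃ q ∉ F, ∃ k w, (E.state k q).rbcOut l = some w := by
  have ofReady {q : Fin n} (hq : q ∉ F) {k : ℕ} (h : (E.state k q).rbcReady l = true) :
      ∃ q ∉ F, ∃ k w, (E.state k q).rbcOut l = some w :=
    ⟨q, hq, k, Option.isSome_iff_exists.1 ((E.inv hn hq k).1.rbcReady l h)⟩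
  obtain ⟨-, hv⟩ := (E.inv hn hp k).2.1.broadcast l _ h
  obtain ⟨rfl, rfl⟩ := Prod.ext_iff.1 hv
  rcases Bool.or_eq_true_iff.1 hab with h1 | h1
  · exact ofReady hp h1
  · have := (E.inv hn hp k).1.rbcFinish l h1
    obtain ⟨q, hq, k', -, hm⟩ := E.exists_honest_sender hF hp (m := .rbcReady l) (k := k) (by omega)
    exact ofReady hq ((E.inv hn hq k').1.sent_rbcReady l hm)

theorem exists_honest_value (hn : 3 * t + 1 ≤ n) (hF : F.card ≤ t) {i : Fin n} (hi : i ∉ F)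
    {k : ℕ} {id : BiasedId n} {P : Bool × Bool → Bool}
    (h : t + 1 ≤ (E.state k i).valueTally id P) :
    ∃ p ∉ F, ∃ k a b, (E.state k p).biasedIn id = some (a, b) ∧ P (a, b) = true := by
  have := card_le_honest_add hF
    (Finset.univ.filter fun p => ((E.state k i).values id p).any P = true)
  unfold valueTally at h
  obtain ⟨p, hp⟩ := Finset.card_pos.1 (show 0 < ((Finset.univ.filter fun p =>
    ((E.state k i).values id p).any P = true) \ F).card by omega)
  simp only [Finset.mem_sdiff, Finset.mem_filter, Finset.mem_univ, true_and,
    Option.any_eq_true] at hp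
  obtain ⟨⟨⟨a, b⟩, hv, hP⟩, hpF⟩ := hp
  obtain ⟨k', hk'⟩ := E.biasedIn_of_values hn hi hpF hv
  exact ⟨p, hpF, k', a, b, hk', hP⟩

/-- If the biased agreement on a broadcast outputs `1`, then the broadcast outputs. -/
theorem exists_rbcOut (hn : 3 * t + 1 ≤ n) (hF : F.card ≤ t) {i l : Fin n} (hi : i ∉ F) {k : ℕ}
    (h : (E.state k i).biasedOut (l, none) = some true) :
    ∃ w, ∀ q ∉ F, ∃ k, (E.state k q).rbcOut l = some w := by
  have : ∃ q ∉ F, ∃ k w, (E.state k q).rbcOut l = some w := by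
    rcases (E.inv hn hi k).2.1.out_true _ h with ⟨a, b, h1, h2⟩ | h1 | h1
    · exact E.exists_rbcOut_of_biasedIn hn hF hi h1 h2
    · obtain ⟨p, hp, k, a, b, h3, h4⟩ := E.exists_honest_value hn hF hi h1
      exact E.exists_rbcOut_of_biasedIn hn hF hp h3 (by simp_all)
    · obtain ⟨p, hp, k, a, b, h3, h4⟩ := E.exists_honest_value hn hF hi h1
      exact E.exists_rbcOut_of_biasedIn hn hF hp h3 (by simp_all)
  obtain ⟨q, hq, k, w, hw⟩ := this
  refine ⟨w, fun q' hq' => ?_⟩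
  obtain ⟨w', k', hw'⟩ := (E.rbc l).totality q hq w ⟨k, hw⟩ q' hq'
  obtain rfl := (E.rbc l).consistency q hq q' hq' w w' ⟨k, hw⟩ ⟨k', hw'⟩
  exact ⟨k', hw'⟩

/-! ### Liveness of the dispersal -/

theorem eventually_le_tally {i : Fin n} (hi : i ∉ F) {m : Msg n} {A : Finset (Fin n)}
    (h : ∀ p ∈ A, p ∉ F ∧ ∃ k, m ∈ (E.state k p).sent) :
    ∀ᶠ k in atTop, A.card ≤ (E.state k i).tally m := by
  have : ∀ᶠ k in atTop, ∀ p ∈ A, (p, m) ∈ (E.state k i).received := by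
    refine (Filter.eventually_all_finset A).2 fun p hp => ?_
    obtain ⟨hpF, k, hk⟩ := h p hp
    exact E.eventually_of_exists i (P := fun s => (p, m) ∈ s.received)
      (fun s s' e h => e.received h) (E.delivery p hpF i hi k m hk)
  filter_upwards [this] with k hk
  exact Finset.card_le_card fun p hp => by simpa using hk p hp

theorem eventually_le_tally_of_all (hF : F.card ≤ t) {i : Fin n} (hi : i ∉ F) {m : Msg n}
    (h : ∀ p ∉ F, ∃ k, m ∈ (E.state k p).sent) :
    ∀ᶠ k in atTop, n - t ≤ (E.state k i).tally m := by
  filter_upwards [E.eventually_le_tally hi (A := Fᶜ) (m := m) fun p hp => by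
    have hp := Finset.mem_compl.1 hp
    exact ⟨hp, h p hp⟩] with k hk
  exact (card_honest hF).trans hk

/-- Handlers are switched off on return, so fairness is usable only at a node that never returns.
The liveness lemmas below therefore argue under that assumption or derive it by contradiction. -/
theorem dispersal_progress {i : Fin n} (hi : i ∉ F) (hr : ∀ k, (E.state k i).returned = false)
    (d : Dispersal n) (h : ∀ᶠ k in atTop, (d.run n t i (E.state k i)).isSome) :
    ∃ k, d.run n t i (E.state k i) = some (E.state (k + 1) i) := by
  obtain ⟨k, hk⟩ := eventually_atTop.1 h
  obtain ⟨k', -, hk'⟩ := E.progress i hi (.dispersal d) k fun k' hk' => by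
    simp [Handler.run, hr, hk k' hk']
  refine ⟨k', ?_⟩
  simpa [Handler.run, hr] using hk'

/-- At least `t + 1` of the `2 * t + 1` CONFIRMs behind a return are honest and reach `q`. If `q`
never sent CONFIRM it would never return, so its amplification handler would stay enabled. -/
theorem sent_confirm_of_returned (hn : 3 * t + 1 ≤ n) (hF : F.card ≤ t) {i : Fin n} (hi : i ∉ F)
    {k : ℕ} (h : (E.state k i).returned = true) {q : Fin n} (hq : q ∉ F) :
    ∃ k, .confirm ∈ (E.state k q).sent := by
  obtain ⟨A, hA, hm⟩ := E.honest_senders hF hi k .confirm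
  have hc := ((E.inv hn hi k).1.returned h).2
  have hT := E.eventually_le_tally hq (A := A) (m := .confirm) fun p hp =>
    ⟨(hm p hp).1, (hm p hp).2.choose, (hm p hp).2.choose_spec.2⟩
  by_contra! hno
  have hr : ∀ k, (E.state k q).returned = false := fun k => by
    by_contra hr
    exact hno k ((E.inv hn hq k).1.returned (by simpa using hr)).1
  obtain ⟨k', hk'⟩ := E.dispersal_progress hq hr .amplify <| by
    filter_upwards [hT] with k hk
    simp only [Dispersal.run]
    rw [if_pos ⟨by omega, hno k⟩]
    rfl
  refine hno (k' + 1) ?_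
  simp only [Dispersal.run] at hk'
  split_ifs at hk' with hc
  rw [← Option.some_inj.1 hk']
  exact Finset.mem_insert_self _ _

theorem returned_of_sent_confirm (hn : 3 * t + 1 ≤ n) (hF : F.card ≤ t)
    (h : ∀ p ∉ F, ∃ k, .confirm ∈ (E.state k p).sent) {i : Fin n} (hi : i ∉ F) :
    ∃ k, (E.state k i).returned = true := by
  by_contra! hno
  obtain ⟨k', hk'⟩ := E.dispersal_progress hi (fun k => by simpa using hno k) .finalize <| by
    filter_upwards [E.eventually_le_tally_of_all hF hi h] with k hk
    simp only [Dispersal.run]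
    rw [if_pos (by omega)]
    rfl
  refine hno (k' + 1) ?_
  simp only [Dispersal.run] at hk'
  split_ifs at hk' with hc
  rw [← Option.some_inj.1 hk']
  rfl

theorem all_returned (hn : 3 * t + 1 ≤ n) (hF : F.card ≤ t) {i : Fin n} (hi : i ∉ F)
    {k : ℕ} (h : (E.state k i).returned = true) {q : Fin n} (hq : q ∉ F) :
    ∃ k, (E.state k q).returned = true :=
  E.returned_of_sent_confirm hn hF (fun _ hp => E.sent_confirm_of_returned hn hF hi h hp) hq

theorem exists_vote (hr : ∀ i ∉ F, ∀ k, (E.state k i).returned = false) {i j : Fin n}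
    (hi : i ∉ F) (h : ∃ k, ((E.state k i).input j).isSome) :
    ∃ b k, .vote j b ∈ (E.state k i).sent := by
  obtain ⟨k, hk⟩ := E.dispersal_progress hi (hr i hi) (.vote j) <| by
    filter_upwards [E.eventually_of_exists i (P := fun s => (s.input j).isSome)
      (fun s s' e => e.input j) h] with k hk
    simpa [Dispersal.run] using hk
  obtain ⟨b, -, hb⟩ := Option.map_eq_some_iff.1 hk
  refine ⟨b, k + 1, ?_⟩
  rw [← hb]
  exact Finset.mem_insert_self _ _

theorem exists_sent_finish (hn : 3 * t + 1 ≤ n) (hF : F.card ≤ t)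
    (hr : ∀ i ∉ F, ∀ k, (E.state k i).returned = false) {j : Fin n}
    (h : ∀ i ∉ F, ∃ k, ((E.state k i).input j).isSome) :
    ∃ b, ∀ i ∉ F, ∃ k, .finish j b ∈ (E.state k i).sent := by
  have hv : ∃ b, ∃ A : Finset (Fin n), t + 1 ≤ A.card ∧
      ∀ p ∈ A, p ∉ F ∧ ∃ k, .vote j b ∈ (E.state k p).sent := by
    classical
    let A (b : Bool) := Fᶜ.filter fun p => ∃ k, Msg.vote j b ∈ (E.state k p).sent
    -- Pigeonhole: every honest node votes for some bit, possibly both, and `n - t ≥ 2 * t + 1`, so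
    -- one class has at least `t + 1` members.
    have hA : n - t ≤ (A true).card + (A false).card := by
      refine (card_honest hF).trans ((Finset.card_le_card fun p hp => ?_).trans
        (Finset.card_union_le _ _))
      obtain ⟨b, hb⟩ := E.exists_vote hr (Finset.mem_compl.1 hp) (h p (Finset.mem_compl.1 hp))
      cases b <;> simp only [A, Finset.mem_union, Finset.mem_filter] <;> tauto
    have mem (b) : ∀ p ∈ A b, p ∉ F ∧ ∃ k, .vote j b ∈ (E.state k p).sent := fun p hp => by
      simpa [A] using hp
    by_cases hc : t + 1 ≤ (A true).card
    · exact ⟨true, _, hc, mem true⟩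
    · exact ⟨false, _, by omega, mem false⟩
  obtain ⟨b, A, hA, hv⟩ := hv
  have hready : ∀ i ∉ F, ∃ k, .ready j b ∈ (E.state k i).sent := by
    intro i hi
    obtain ⟨k, hk⟩ := E.dispersal_progress hi (hr i hi) (.ready j b) <| by
      filter_upwards [E.eventually_le_tally hi hv] with k hk
      simp only [Dispersal.run]
      rw [if_pos (by omega)]
      rfl
    refine ⟨k + 1, ?_⟩
    simp only [Dispersal.run] at hk
    split_ifs at hk
    rw [← Option.some_inj.1 hk]
    exact Finset.mem_insert_self _ _
  refine ⟨b, fun i hi => ?_⟩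
  obtain ⟨k, hk⟩ := E.dispersal_progress hi (hr i hi) (.finish j b) <| by
    filter_upwards [E.eventually_le_tally_of_all hF hi hready] with k hk
    simp only [Dispersal.run]
    rw [if_pos hk]
    rfl
  refine ⟨k + 1, ?_⟩
  simp only [Dispersal.run] at hk
  split_ifs at hk
  rw [← Option.some_inj.1 hk]
  exact Finset.mem_insert_self _ _

theorem exists_record (hn : 3 * t + 1 ≤ n) (hF : F.card ≤ t)
    (hr : ∀ i ∉ F, ∀ k, (E.state k i).returned = false) {j : Fin n}
    (h : ∀ i ∉ F, ∃ k, ((E.state k i).input j).isSome) {i : Fin n} (hi : i ∉ F) :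
    ∃ k, ((E.state k i).record j).isSome := by
  obtain ⟨b, hb⟩ := E.exists_sent_finish hn hF hr h
  -- The recording handler is enabled only while the entry is missing. A dishonestly induced other
  -- bit may come first, hence only presence is claimed.
  by_contra! hno
  obtain ⟨k, hk⟩ := E.dispersal_progress hi (hr i hi) (.record j b) <| by
    filter_upwards [E.eventually_le_tally_of_all hF hi hb] with k hk
    simp only [Dispersal.run]
    rw [if_pos ⟨hk, by simpa using hno k⟩]
    rfl
  refine hno (k + 1) ?_
  simp only [Dispersal.run] at hk
  rw [if_pos (by by_contra hc; rw [if_neg hc] at hk; cases hk)] at hk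
  rw [← Option.some_inj.1 hk]
  simp

theorem exists_rbcOut_of_inputs (hn : 3 * t + 1 ≤ n) (hF : F.card ≤ t) (hin : E.CommonInputs)
    (hr : ∀ i ∉ F, ∀ k, (E.state k i).returned = false) {l : Fin n} (hl : l ∉ F) :
    ∃ w, ∀ i ∉ F, ∃ k, (E.state k i).rbcOut l = some w := by
  obtain ⟨J, hJ, hin⟩ := hin
  have : ∀ᶠ k in atTop, ∀ j ∈ J, ((E.state k l).record j).isSome := by
    refine (Filter.eventually_all_finset J).2 fun j hj => ?_
    refine E.eventually_of_exists l (P := fun s => (s.record j).isSome) (fun s s' e h => ?_)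
      (E.exists_record hn hF hr (fun i hi => hin i hi j hj) hl)
    obtain ⟨b, hb⟩ := Option.isSome_iff_exists.1 h
    simp [e.record j b hb]
  obtain ⟨k, hk⟩ := this.exists
  have hI := (E.inv hn hl k).1
  have hc : n - t ≤ (E.state k l).count := by
    rw [hI.count]
    exact hJ.trans (Finset.card_le_card fun j hj => by simpa [nonmissing] using hk j hj)
  obtain ⟨w, hw⟩ := Option.isSome_iff_exists.1 (hI.rbcIn_isSome hc)
  exact ⟨w, (E.rbc l).validity hl w ⟨k, hw⟩⟩

theorem exists_sent_election (hn : 3 * t + 1 ≤ n) (hF : F.card ≤ t) (hin : E.CommonInputs)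
    (hr : ∀ i ∉ F, ∀ k, (E.state k i).returned = false) {l : Fin n} (hl : l ∉ F) :
    ∃ k, .election ∈ (E.state k l).sent := by
  obtain ⟨w, hw⟩ := E.exists_rbcOut_of_inputs hn hF hin hr hl
  have hready : ∀ i ∉ F, ∃ k, .rbcReady l ∈ (E.state k i).sent := by
    intro i hi
    obtain ⟨k, hk⟩ := E.dispersal_progress hi (hr i hi) (.rbcReady l) <| by
      filter_upwards [E.eventually_of_exists i (P := fun s => s.rbcOut l = some w)
        (fun s s' e h => e.rbcOut _ _ h) (hw i hi)] with k hk
      simp [Dispersal.run, hk]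
    refine ⟨k + 1, ?_⟩
    simp only [Dispersal.run] at hk
    split_ifs at hk
    rw [← Option.some_inj.1 hk]
    exact Finset.mem_insert_self _ _
  have hfinish : ∀ i ∉ F, ∃ k, .rbcFinish l ∈ (E.state k i).sent := by
    intro i hi
    obtain ⟨k, hk⟩ := E.dispersal_progress hi (hr i hi) (.rbcFinish l) <| by
      filter_upwards [E.eventually_le_tally_of_all hF hi hready] with k hk
      simp only [Dispersal.run]
      rw [if_pos hk]
      rfl
    refine ⟨k + 1, ?_⟩
    simp only [Dispersal.run] at hk
    split_ifs at hk
    rw [← Option.some_inj.1 hk]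
    exact Finset.mem_insert_self _ _
  obtain ⟨k, hk⟩ := E.dispersal_progress hl (hr l hl) .election <| by
    filter_upwards [E.eventually_le_tally_of_all hF hl hfinish] with k hk
    simp only [Dispersal.run]
    rw [if_pos hk]
    rfl
  refine ⟨k + 1, ?_⟩
  simp only [Dispersal.run] at hk
  split_ifs at hk
  rw [← Option.some_inj.1 hk]
  exact Finset.mem_insert_self _ _

/-- The dispersal returns at every honest node. -/
theorem exists_returned (hn : 3 * t + 1 ≤ n) (hF : F.card ≤ t) (hin : E.CommonInputs)
    {i : Fin n} (hi : i ∉ F) : ∃ k, (E.state k i).returned = true := by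
  -- Either nobody returns and all handlers run to the end of the cascade, or one return drags the
  -- others along by amplification.
  by_cases hr : ∀ i ∉ F, ∀ k, (E.state k i).returned = false
  · refine E.returned_of_sent_confirm hn hF (fun p hp => ?_) hi
    by_contra! hno
    obtain ⟨k', hk'⟩ := E.dispersal_progress hp (hr p hp) .confirm <| by
      filter_upwards [E.eventually_le_tally_of_all hF hp
        fun l hl => E.exists_sent_election hn hF hin hr hl] with k hk
      simp only [Dispersal.run]
      rw [if_pos ⟨hk, hno k⟩]
      rfl
    refine hno (k' + 1) ?_
    simp only [Dispersal.run] at hk'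
    split_ifs at hk' with hc
    rw [← Option.some_inj.1 hk']
    exact Finset.mem_insert_self _ _
  · push Not at hr
    obtain ⟨p, hp, k, hk⟩ := hr
    exact E.all_returned hn hF hp (k := k) (by simpa using hk) hi

/-! ### Dispersals completed before the first coin -/

/-- Amplified CONFIRMs point to strictly earlier honest CONFIRMs. The descent ends at a node that
confirmed because of `n - t` ELECTION messages. -/
theorem exists_election_of_confirm (hn : 3 * t + 1 ≤ n) (hF : F.card ≤ t) {p : Fin n} (hp : p ∉ F)
    {k : ℕ} (h : .confirm ∈ (E.state k p).sent) :
    ∃ q ∉ F, n - t ≤ (E.state k q).tally .election := by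
  induction k using Nat.strong_induction_on generalizing p with
  | _ k ih =>
    rcases (E.inv hn hp k).1.sent_confirm h with h1 | h1
    · exact ⟨p, hp, h1⟩
    · obtain ⟨q, hq, k', hk', hm⟩ := E.exists_honest_sender hF hp h1
      obtain ⟨q', hq', hT⟩ := ih k' hk' hq hm
      exact ⟨q', hq', hT.trans ((E.extends_of_le q' hk'.le).tally _)⟩

/-- When the first honest node returns from the dispersal, the dispersals of `n - 2 * t` honest
nodes are complete. -/
theorem exists_completed (hn : 3 * t + 1 ≤ n) (hF : F.card ≤ t) (hin : E.CommonInputs) :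
    ∃ I : Finset (Fin n), E.Completed I ∧ n - 2 * t ≤ I.card := by
  classical
  have hex : ∃ k, ∃ i ∉ F, (E.state k i).returned = true := by
    obtain ⟨i, hi⟩ := exists_honest (F := F) hn hF
    obtain ⟨k, hk⟩ := E.exists_returned hn hF hin hi
    exact ⟨k, i, hi, hk⟩
  obtain ⟨i, hi, hret⟩ := Nat.find_spec hex
  have hmin := fun k => Nat.find_min hex (m := k)
  cases hk : Nat.find hex with
  | zero => simp [hk, E.init i hi, NodeState.init] at hret
  | succ k =>
    rw [hk] at hret hmin
    -- Time `k` immediately precedes the first return. The CONFIRM quorum is already present then,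
    -- while no coin can be active because coins require a return.
    have hno : ∀ i ∉ F, (E.state k i).returned = false := fun i hi => by
      by_contra hc
      exact hmin k k.lt_succ_self ⟨i, hi, by simpa using hc⟩
    have hT : 2 * t + 1 ≤ (E.state k i).tally .confirm := by
      rcases E.transition i k with e | e
      · rw [e, hno i hi] at hret
        cases hret
      · rcases e.returned_effect hret with h | h
        · rw [hno i hi] at h
          cases h
        · exact h.2
    obtain ⟨p, hp, k', hk', hm⟩ := E.exists_honest_sender hF hi (m := .confirm) (k := k) (by omega)
    obtain ⟨q, hq, hT⟩ := E.exists_election_of_confirm hn hF hp hm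
    obtain ⟨A, hA, hm⟩ := E.honest_senders hF hq k' .election
    refine ⟨A, ⟨fun l hl => (hm l hl).1, k, fun l hl => ?_, fun i hi r => ?_⟩, by omega⟩
    · obtain ⟨k'', hk'', hs⟩ := (hm l hl).2
      exact (E.extends_of_le l (hk''.trans hk').le).sent hs
    · by_contra hc
      have := ((E.inv hn hi k).2.2.coinOn r (by simpa using hc)).1
      rw [hno i hi] at this
      cases this

/-! ### Progress of the main loop and of the agreements -/

/-- If the phase stays `p`, fairness runs the main handler. Otherwise consider the first time it
leaves `p`: only the main handler changes phases, so that step is the one sought. -/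
theorem main_progress {i : Fin n} (hi : i ∉ F) {k₀ : ℕ} {p : Phase n}
    (hp : (E.state k₀ i).phase = p)
    (h : ∀ᶠ k in atTop, (E.state k i).phase = p → (mainStep n t (E.state k i)).isSome) :
    ∃ k, (E.state k i).phase = p ∧
      mainStep n t (E.state k i) = some (E.state (k + 1) i) := by
  by_cases hc : ∀ k ≥ k₀, (E.state k i).phase = p
  · obtain ⟨k₁, hk₁⟩ := eventually_atTop.1 h
    obtain ⟨k, hk, hs⟩ := E.progress i hi .main (max k₀ k₁) fun k hk =>
      hk₁ k (le_of_max_le_right hk) (hc k (le_of_max_le_left hk))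
    exact ⟨k, hc k (le_of_max_le_left hk), hs⟩
  · have hex : ∃ d, (E.state (k₀ + d) i).phase ≠ p := by
      push Not at hc
      obtain ⟨k, hk, hne⟩ := hc
      exact ⟨k - k₀, by rwa [Nat.add_sub_cancel' hk]⟩
    classical
    have hd := Nat.find_spec hex
    cases hf : Nat.find hex with
    | zero => exact absurd hp (by simpa [hf] using hd)
    | succ d =>
      rw [hf] at hd
      have hk : (E.state (k₀ + d) i).phase = p :=
        not_not.1 (Nat.find_min hex (m := d) (by omega))
      refine ⟨k₀ + d, hk, ?_⟩
      rw [← add_assoc] at hd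
      rcases E.localStep i (k₀ + d) with e | e
      · rw [e] at hd
        exact absurd hk hd
      · exact e.phase_effect.resolve_left fun e => hd (e.trans hk)

/-- Under `hsup`, a single honest second bit `1` forces `t + 1` honest first bits `1`. Hence either
the ones suffice for output `1`, or all honest second bits are `0` and the zeros suffice. -/
theorem eventually_biasedOut (hF : F.card ≤ t) (hn : 3 * t + 1 ≤ n) {id : BiasedId n}
    (hin : ∀ p ∉ F, ∃ k, ((E.state k p).biasedIn id).isSome)
    (hsup : ∀ p ∉ F, ∀ k a, (E.state k p).biasedIn id = some (a, true) →
      ∃ A : Finset (Fin n), t + 1 ≤ A.card ∧ ∀ q ∈ A, q ∉ F ∧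
        ∀ k v, (E.state k q).biasedIn id = some v → v.1 = true)
    {i : Fin n} (hi : i ∉ F) : ∀ᶠ k in atTop, ((E.state k i).biasedOut id).isSome := by
  refine E.eventually_of_exists i (P := fun s => (s.biasedOut id).isSome)
    (fun s s' e => e.biasedOut id) ?_
  by_contra! hno
  have arrive (P : Bool × Bool → Bool) (A : Finset (Fin n))
      (hA : ∀ q ∈ A, q ∉ F ∧ ∀ k v, (E.state k q).biasedIn id = some v → P v = true) :
      ∀ᶠ k in atTop, A.card ≤ (E.state k i).valueTally id P := by
    have : ∀ᶠ k in atTop, ∀ q ∈ A, ((E.state k i).values id q).any P = true := by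
      refine (Filter.eventually_all_finset A).2 fun q hq => ?_
      obtain ⟨hqF, hP⟩ := hA q hq
      obtain ⟨k, hk⟩ := hin q hqF
      obtain ⟨⟨a, b⟩, hv⟩ := Option.isSome_iff_exists.1 hk
      obtain ⟨k', hk'⟩ := E.delivery q hqF i hi k _ ((E.inv hn hqF k).2.1.value_sent id a b hv)
      obtain ⟨⟨a', b'⟩, hv'⟩ := Option.isSome_iff_exists.1
        ((E.inv hn hi k').2.1.values_isSome _ _ _ _ hk')
      -- The recorded first pair is not assumed to be the delivered one. It is traced back to an
      -- input of `q`, to which `hA` applies.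
      obtain ⟨k'', hk''⟩ := E.biasedIn_of_values hn hi hqF hv'
      refine E.eventually_of_exists i (P := fun s => (s.values id q).any P = true)
        (fun s s' e h => ?_) ⟨k', ?_⟩
      · obtain ⟨v, hv, hP⟩ := Option.any_eq_true _ _ |>.1 h
        exact (Option.any_eq_true _ _).2 ⟨v, e.values _ _ _ hv, hP⟩
      · exact (Option.any_eq_true _ _).2 ⟨_, hv', hP k'' _ hk''⟩
    filter_upwards [this] with k hk
    exact Finset.card_le_card fun q hq => by simpa using hk q hq
  have hI := E.eventually_of_exists i (P := fun s => (s.biasedIn id).isSome)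
    (fun s s' e h => e.biasedIn_isSome h) (hin i hi)
  have hen : ∀ᶠ k in atTop, (biasedStep n t (E.state k i) id).isSome := by
    by_cases hs : ∃ A : Finset (Fin n), t + 1 ≤ A.card ∧ ∀ q ∈ A, q ∉ F ∧
        ∀ k v, (E.state k q).biasedIn id = some v → v.1 = true
    · obtain ⟨A, hA, hv⟩ := hs
      filter_upwards [hI, arrive _ A hv] with k hk hT
      unfold biasedStep
      rw [if_pos ⟨hk, by simpa using hno k⟩, if_pos (.inl (hA.trans hT))]
      rfl
    · have h0 := arrive (fun v => !v.2) Fᶜ fun q hq => by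
        have hq := Finset.mem_compl.1 hq
        refine ⟨hq, ?_⟩
        rintro k ⟨a, b⟩ hv
        cases b
        · rfl
        · exact absurd (hsup q hq k a hv) hs
      filter_upwards [hI, h0] with k hk hT
      unfold biasedStep
      rw [if_pos ⟨hk, by simpa using hno k⟩]
      split_ifs with hc
      · rfl
      · rfl
      · exact absurd ((card_honest hF).trans hT) (by assumption)
  obtain ⟨k₀, hk₀⟩ := eventually_atTop.1 hen
  obtain ⟨k, -, hk⟩ := E.progress i hi (.biased id) k₀ hk₀
  refine hno (k + 1) ?_
  simp only [Handler.run, biasedStep] at hk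
  split_ifs at hk
  all_goals
    rw [← Option.some_inj.1 hk]
    exact isSome_setOnce_self _ _ _

theorem eventually_biasedOut_broadcast (hn : 3 * t + 1 ≤ n) (hF : F.card ≤ t) {l : Fin n}
    (hin : ∀ p ∉ F, ∃ k, ((E.state k p).biasedIn (l, none)).isSome) {i : Fin n} (hi : i ∉ F) :
    ∀ᶠ k in atTop, ((E.state k i).biasedOut (l, none)).isSome := by
  refine E.eventually_biasedOut hF hn hin (fun p hp k a ha => ?_) hi
  obtain ⟨-, hv⟩ := (E.inv hn hp k).2.1.broadcast l _ ha
  have hT := (E.inv hn hp k).1.rbcFinish l (Prod.ext_iff.1 hv).2.symm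
  -- The honest part of the READY quorum behind the second bit `1` is the required set of first bits
  -- `1`.
  obtain ⟨A, hA, hm⟩ := E.honest_senders hF hp k (.rbcReady l)
  refine ⟨A, by omega, fun q hq => ⟨(hm q hq).1, fun k v hv => ?_⟩⟩
  obtain ⟨hqF, k', -, hs⟩ := hm q hq
  exact (E.biasedIn_broadcast hn hqF hv k').1 ((E.inv hn hqF k').1.sent_rbcReady l hs)

theorem eventually_biasedOut_vector (hn : 3 * t + 1 ≤ n) (hF : F.card ≤ t) {l j : Fin n}
    (hin : ∀ p ∉ F, ∃ k, ((E.state k p).biasedIn (l, some j)).isSome) {i : Fin n} (hi : i ∉ F) :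
    ∀ᶠ k in atTop, ((E.state k i).biasedOut (l, some j)).isSome := by
  refine E.eventually_biasedOut hF hn hin (fun p hp k a ha => ?_) hi
  obtain ⟨-, w, c, hw, hc, hv⟩ := (E.inv hn hp k).2.1.vector l j _ ha
  have hT := (E.inv hn hp k).1.finish j c (Prod.ext_iff.1 hv).2.symm
  obtain ⟨A, hA, hm⟩ := E.honest_senders hF hp k (.ready j c)
  refine ⟨A, by omega, fun q hq => ⟨(hm q hq).1, fun k v hv => ?_⟩⟩
  obtain ⟨hqF, k', -, hs⟩ := hm q hq
  exact (E.biasedIn_vector hn hqF hv hp hw hc k').1 ((E.inv hn hqF k').1.sent_ready j c hs)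

/-- If all honest nodes give an input to a binary agreement, they all obtain the input of one of
them. -/
theorem exists_agreeOut (hn : 3 * t + 1 ≤ n) (hF : F.card ≤ t) {id : AgreeId n}
    (h : ∀ i ∉ F, ∃ k, ((E.state k i).agreeIn id).isSome) :
    ∃ v, (∀ i ∉ F, ∃ k, (E.state k i).agreeOut id = some v) ∧
      ∃ i ∉ F, ∃ k, (E.state k i).agreeIn id = some v := by
  obtain ⟨i₀, hi₀⟩ := exists_honest (F := F) hn hF
  have hin : ∀ i ∉ F, ∃ v, ∃ k, (E.state k i).agreeIn id = some v := fun i hi => by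
    obtain ⟨k, hk⟩ := h i hi
    obtain ⟨v, hv⟩ := Option.isSome_iff_exists.1 hk
    exact ⟨v, k, hv⟩
  obtain ⟨v, hv⟩ := (E.agree id).termination hin i₀ hi₀
  refine ⟨v, (E.agree id).consistency i₀ hi₀ v hv, ?_⟩
  -- If `v` were no honest input, all honest inputs would be `!v`, and validity would force that
  -- output.
  by_contra! hno
  obtain ⟨k, hk⟩ := hv
  obtain ⟨k', hk'⟩ := (E.agree id).validity (!v) (fun i hi => by
    obtain ⟨u, k, hu⟩ := hin i hi
    have : u ≠ v := fun e => hno i hi k (e ▸ hu)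
    exact ⟨k, by rw [hu, Bool.eq_not.2 this]⟩) i₀ hi₀
  have := E.agreeOut_unique hk hk'
  cases v <;> cases this

/-! ### Moving through the phases of a round -/

/-- Node `i` leaves round `r` without output. -/
def Leaves (i r : Fin n) : Prop :=
  (∃ k, (E.state k i).Passed t r) ∧ ∀ h : r.1 + 1 < n, E.Reaches i ⟨r.1 + 1, h⟩

theorem leaves_of_step (hn : 3 * t + 1 ≤ n) {i r l : Fin n} (hi : i ∉ F) {k : ℕ}
    (h : (E.state k i).Leaves t r l) (hs : (E.state k i).leaveRound r = E.state (k + 1) i) :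
    E.Leaves i r := by
  refine ⟨⟨k, (h.passed (E.inv hn hi k).2.2.phase).2⟩, fun hr => ⟨k + 1, ?_⟩⟩
  rw [← hs]
  simp [leaveRound, hr, beginRound]

theorem exists_electing {i r : Fin n} (hi : i ∉ F) (h : E.Reaches i r) :
    ∃ k, (E.state k i).phase = .electing r := by
  obtain ⟨k, hk⟩ := h
  induction k with
  | zero => simp [E.init i hi, NodeState.init] at hk
  | succ k ih =>
    rcases E.transition i k with e | e
    · exact ih (e ▸ hk)
    · rcases e.coinOn_effect hk with h | h
      · exact ih h
      · exact ⟨k + 1, h.1⟩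

theorem exists_biased {i r l : Fin n} (hi : i ∉ F) (h : ∃ k, (E.state k i).phase = .electing r)
    (hl : E.Elects i r l) : ∃ k, (E.state k i).phase = .biased r l := by
  obtain ⟨k₀, hk₀⟩ := h
  obtain ⟨k, hp, hs⟩ := E.main_progress hi hk₀ <| by
    filter_upwards [E.eventually_of_exists i (P := fun s => s.coinOut r = some l)
      (fun s s' e h => e.coinOut _ _ h) hl] with k hk hp
    simp [mainStep, hp, hk]
  simp only [mainStep, hp] at hs
  obtain ⟨l', hl', e⟩ := Option.map_eq_some_iff.1 hs
  obtain rfl := (E.coin r).consistency i hi i hi l l' hl ⟨k, hl'⟩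
  exact ⟨k + 1, by rw [← e]⟩

theorem exists_agreeing {i r l : Fin n} (hi : i ∉ F) (h : ∃ k, (E.state k i).phase = .biased r l)
    (hl : ∀ᶠ k in atTop, ((E.state k i).biasedOut (l, none)).isSome) :
    ∃ k, (E.state k i).phase = .agreeing r l := by
  obtain ⟨k₀, hk₀⟩ := h
  obtain ⟨k, hp, hs⟩ := E.main_progress hi hk₀ <| by
    filter_upwards [hl] with k hk hp
    simpa [mainStep, hp] using hk
  simp only [mainStep, hp] at hs
  obtain ⟨v, -, e⟩ := Option.map_eq_some_iff.1 hs
  exact ⟨k + 1, by rw [← e]⟩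

theorem exists_waiting {i r l : Fin n} (hi : i ∉ F) (h : ∃ k, (E.state k i).phase = .agreeing r l)
    (hl : ∃ k, (E.state k i).agreeOut (l, .broadcast) = some true) :
    ∃ k, (E.state k i).phase = .waiting r l := by
  obtain ⟨k₀, hk₀⟩ := h
  obtain ⟨k, hp, hs⟩ := E.main_progress hi hk₀ <| by
    filter_upwards [E.eventually_of_exists i
      (P := fun s => s.agreeOut (l, .broadcast) = some true)
      (fun s s' e h => e.agreeOut _ _ h) hl] with k hk hp
    simp [mainStep, hp, hk]
  simp only [mainStep, hp] at hs
  obtain ⟨v, hv, e⟩ := Option.map_eq_some_iff.1 hs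
  obtain ⟨k₁, hk₁⟩ := hl
  obtain rfl := E.agreeOut_unique hv hk₁
  exact ⟨k + 1, by rw [← e]; rfl⟩

theorem leaves_of_agreeing (hn : 3 * t + 1 ≤ n) {i r l : Fin n} (hi : i ∉ F)
    (h : ∃ k, (E.state k i).phase = .agreeing r l)
    (hl : ∃ k, (E.state k i).agreeOut (l, .broadcast) = some false) : E.Leaves i r := by
  obtain ⟨k₀, hk₀⟩ := h
  obtain ⟨k, hp, hs⟩ := E.main_progress hi hk₀ <| by
    filter_upwards [E.eventually_of_exists i
      (P := fun s => s.agreeOut (l, .broadcast) = some false)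
      (fun s s' e h => e.agreeOut _ _ h) hl] with k hk hp
    simp [mainStep, hp, hk]
  simp only [mainStep, hp] at hs
  obtain ⟨v, hv, e⟩ := Option.map_eq_some_iff.1 hs
  obtain ⟨k₁, hk₁⟩ := hl
  obtain rfl := E.agreeOut_unique hv hk₁
  exact E.leaves_of_step hn hi (.inl ⟨hp, hv⟩) e

theorem exists_checking_or_leaves (hn : 3 * t + 1 ≤ n) {i r l : Fin n} (hi : i ∉ F)
    (h : ∃ k, (E.state k i).phase = .waiting r l) {w : Vec n}
    (hl : ∃ k, (E.state k i).rbcOut l = some w) :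
    (n - t ≤ (nonmissing w).card → ∃ k, (E.state k i).phase = .checking r l w) ∧
    ((nonmissing w).card < n - t → E.Leaves i r) := by
  obtain ⟨k₀, hk₀⟩ := h
  obtain ⟨k, hp, hs⟩ := E.main_progress hi hk₀ <| by
    filter_upwards [E.eventually_of_exists i (P := fun s => s.rbcOut l = some w)
      (fun s s' e h => e.rbcOut _ _ h) hl] with k hk hp
    simp [mainStep, hp, hk]
  simp only [mainStep, hp] at hs
  obtain ⟨w', hw', e⟩ := Option.map_eq_some_iff.1 hs
  obtain rfl := (E.rbc l).consistency i hi i hi w w' hl ⟨k, hw'⟩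
  constructor
  · intro hc
    rw [if_pos hc] at e
    exact ⟨k + 1, by rw [← e]⟩
  · intro hc
    rw [if_neg (not_le.2 hc)] at e
    exact E.leaves_of_step hn hi (.inr (.inl ⟨w, hp, hw', hc⟩)) e

theorem exists_deciding {i r l : Fin n} {w : Vec n} (hi : i ∉ F)
    (h : ∃ k, (E.state k i).phase = .checking r l w)
    (hl : ∀ j ∈ nonmissing w, ∀ᶠ k in atTop, ((E.state k i).biasedOut (l, some j)).isSome) :
    ∃ k, (E.state k i).phase = .deciding r l w := by
  obtain ⟨k₀, hk₀⟩ := h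
  obtain ⟨k, hp, hs⟩ := E.main_progress hi hk₀ <| by
    filter_upwards [(Filter.eventually_all_finset _).2 hl] with k hk hp
    simp only [mainStep, hp]
    rw [if_pos hk]
    rfl
  simp only [mainStep, hp] at hs
  split_ifs at hs with hc
  exact ⟨k + 1, by rw [← Option.some_inj.1 hs]⟩

theorem leaves_of_deciding (hn : 3 * t + 1 ≤ n) {i r l : Fin n} {w : Vec n} (hi : i ∉ F)
    (h : ∃ k, (E.state k i).phase = .deciding r l w)
    (hl : ∃ k, (E.state k i).agreeOut (l, .vector) = some false) : E.Leaves i r := by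
  obtain ⟨k₀, hk₀⟩ := h
  obtain ⟨k, hp, hs⟩ := E.main_progress hi hk₀ <| by
    filter_upwards [E.eventually_of_exists i
      (P := fun s => s.agreeOut (l, .vector) = some false)
      (fun s s' e h => e.agreeOut _ _ h) hl] with k hk hp
    simp [mainStep, hp, hk]
  simp only [mainStep, hp] at hs
  obtain ⟨v, hv, e⟩ := Option.map_eq_some_iff.1 hs
  obtain ⟨k₁, hk₁⟩ := hl
  obtain rfl := E.agreeOut_unique hv hk₁
  exact E.leaves_of_step hn hi (.inr (.inr ⟨w, hp, hv⟩)) e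

/-- Node `i` outputs a vector in round `r`. -/
def Succeeds (i r : Fin n) : Prop := E.Terminates i ∧ ∀ k, ¬ (E.state k i).Passed t r

theorem succeeds_of_deciding (hn : 3 * t + 1 ≤ n) {i r l : Fin n} {w : Vec n} (hi : i ∉ F)
    (h : ∃ k, (E.state k i).phase = .deciding r l w)
    (hl : ∃ k, (E.state k i).agreeOut (l, .vector) = some true) : E.Succeeds i r := by
  obtain ⟨k₀, hk₀⟩ := h
  have hT : E.Terminates i := by
    obtain ⟨k, hp, hs⟩ := E.main_progress hi hk₀ <| by
      filter_upwards [E.eventually_of_exists i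
        (P := fun s => s.agreeOut (l, .vector) = some true)
        (fun s s' e h => e.agreeOut _ _ h) hl] with k hk hp
      simp [mainStep, hp, hk]
    simp only [mainStep, hp] at hs
    obtain ⟨v, hv, e⟩ := Option.map_eq_some_iff.1 hs
    obtain ⟨k₁, hk₁⟩ := hl
    obtain rfl := E.agreeOut_unique hv hk₁
    exact ⟨k + 1, w, by rw [← e]; rfl⟩
  refine ⟨hT, ?_⟩
  -- The coin, broadcast and agreement outputs known in the `deciding` phase are unique, and they
  -- contradict every way of passing the round.
  have hP := (E.inv hn hi k₀).2.2.phase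
  rw [hk₀] at hP
  obtain ⟨-, hl₁, hb, hw, hc, -⟩ := hP
  obtain ⟨k₁, hk₁⟩ := hl
  rintro k ⟨l', hl', h⟩
  obtain rfl := (E.coin r).consistency i hi i hi l l' ⟨k₀, hl₁⟩ ⟨k, hl'⟩
  rcases h with h | ⟨-, w', hw', h⟩
  · cases E.agreeOut_unique hb h
  · obtain rfl := (E.rbc l).consistency i hi i hi w w' ⟨k₀, hw⟩ ⟨k, hw'⟩
    rcases h with h | ⟨h, -⟩
    · omega
    · cases E.agreeOut_unique hk₁ h

/-! ### The outcome of a round and the sequence of rounds -/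

theorem exists_elects (hn : 3 * t + 1 ≤ n) (hF : F.card ≤ t) {r : Fin n}
    (h : ∀ i ∉ F, E.Reaches i r) : ∃ l, ∀ i ∉ F, E.Elects i r l := by
  obtain ⟨l, hl⟩ := (E.coin r).termination Fᶜ
    (by have := card_honest (n := n) hF; omega)
    fun i hi => ⟨Finset.mem_compl.1 hi, h i (Finset.mem_compl.1 hi)⟩
  exact ⟨l, fun i hi => hl i hi (h i hi)⟩

/-- A round that all honest nodes reach has a common leader; either all honest nodes output in
it, or all of them leave it, and then the dispersal of the leader is not complete. -/
theorem round_dichotomy (hn : 3 * t + 1 ≤ n) (hF : F.card ≤ t) {r : Fin n}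
    (h : ∀ i ∉ F, E.Reaches i r) : ∃ l, (∀ i ∉ F, E.Elects i r l) ∧
      ((∀ i ∉ F, E.Succeeds i r) ∨ ¬ E.Good l ∧ ∀ i ∉ F, E.Leaves i r) := by
  obtain ⟨l, hl⟩ := E.exists_elects hn hF h
  refine ⟨l, hl, ?_⟩
  have hP {i : Fin n} (hi : i ∉ F) (k : ℕ) := (E.inv hn hi k).2.2.phase
  have hbiased : ∀ i ∉ F, ∃ k, (E.state k i).phase = .biased r l := fun i hi =>
    E.exists_biased hi (E.exists_electing hi (h i hi)) (hl i hi)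
  have hout : ∀ i ∉ F, ∀ᶠ k in atTop, ((E.state k i).biasedOut (l, none)).isSome :=
    fun i hi => E.eventually_biasedOut_broadcast hn hF (fun p hp => by
      obtain ⟨k, hk⟩ := hbiased p hp
      have := hP hp k
      rw [hk] at this
      exact ⟨k, this.2.2⟩) hi
  have hagreeing : ∀ i ∉ F, ∃ k, (E.state k i).phase = .agreeing r l := fun i hi =>
    E.exists_agreeing hi (hbiased i hi) (hout i hi)
  obtain ⟨v, hv, i₁, hi₁, k₁, hk₁⟩ := E.exists_agreeOut hn hF (id := (l, .broadcast))
    fun p hp => by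
      obtain ⟨k, hk⟩ := hagreeing p hp
      have := hP hp k
      rw [hk] at this
      exact ⟨k, this.2.2⟩
  have hb := (E.inv hn hi₁ k₁).2.2.agree_broadcast l v hk₁
  cases v with
  | false =>
    exact .inr ⟨fun hg => hg.biasedOut_broadcast hn hF hi₁ k₁ hb,
      fun i hi => E.leaves_of_agreeing hn hi (hagreeing i hi) (hv i hi)⟩
  | true =>
    have hwaiting := fun i hi => E.exists_waiting hi (hagreeing i hi) (hv i hi)
    -- The agreed `1` was the biased output of an honest node, so the broadcast delivers. All honest
    -- nodes get the same `w`, so the size test below has the same result for all.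
    obtain ⟨w, hw⟩ := E.exists_rbcOut hn hF hi₁ hb
    obtain ⟨k₂, hk₂⟩ := hw i₁ hi₁
    by_cases hc : n - t ≤ (nonmissing w).card
    · have hchecking := fun i hi =>
        (E.exists_checking_or_leaves hn hi (hwaiting i hi) (hw i hi)).1 hc
      have hdeciding : ∀ i ∉ F, ∃ k, (E.state k i).phase = .deciding r l w := fun i hi =>
        E.exists_deciding hi (hchecking i hi) fun j hj =>
          E.eventually_biasedOut_vector hn hF (fun p hp => by
            obtain ⟨k, hk⟩ := hchecking p hp
            have := hP hp k
            rw [hk] at this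
            exact ⟨k, this.2.2.2.2.2 j hj⟩) hi
      obtain ⟨v, hv, i₃, hi₃, k₃, hk₃⟩ := E.exists_agreeOut hn hF (id := (l, .vector))
        fun p hp => by
          obtain ⟨k, hk⟩ := hdeciding p hp
          have := hP hp k
          rw [hk] at this
          exact ⟨k, this.2.2.2.2.2⟩
      cases v with
      | true => exact .inl fun i hi => E.succeeds_of_deciding hn hi (hdeciding i hi) (hv i hi)
      | false =>
        refine .inr ⟨fun hg => ?_,
          fun i hi => E.leaves_of_deciding hn hi (hdeciding i hi) (hv i hi)⟩
        obtain ⟨w', hw', j, hj, ho⟩ := (E.inv hn hi₃ k₃).2.2.agree_vector l hk₃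
        exact hg.biasedOut_vector hn hF hi₃ hw' hj hi₃ k₃ ho
    -- A leader with completed dispersal broadcasts exactly `n - t` entries, so it cannot fail the
    -- size test.
    · refine .inr ⟨fun hg => hc (hg.exists_record hn hi₁ hk₂).1.ge, fun i hi =>
        (E.exists_checking_or_leaves hn hi (hwaiting i hi) (hw i hi)).2 (not_le.1 hc)⟩

theorem reaches_zero (hn : 3 * t + 1 ≤ n) (hF : F.card ≤ t) (hin : E.CommonInputs) {i : Fin n}
    (hi : i ∉ F) : E.Reaches i ⟨0, i.pos⟩ := by
  obtain ⟨k, hp, hs⟩ := E.main_progress hi (k₀ := 0) (p := .dispersal)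
    (by rw [E.init i hi]; rfl) <| by
      filter_upwards [E.eventually_of_exists i (P := fun s => s.returned = true)
        (fun s s' e h => (e.returned h).1) (E.exists_returned hn hF hin hi)] with k hk hp
      simp [mainStep, hp, hk, i.pos]
  simp only [mainStep, hp] at hs
  rw [dif_pos i.pos] at hs
  split_ifs at hs
  refine ⟨k + 1, ?_⟩
  rw [← Option.some_inj.1 hs]
  simp [beginRound]

/-- A round is reached by all honest nodes if no earlier round succeeds. -/
theorem reaches_of_not_succeeds (hn : 3 * t + 1 ≤ n) (hF : F.card ≤ t) (hin : E.CommonInputs)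
    {r : Fin n} (h : ∀ r' < r, ¬ ∀ i ∉ F, E.Succeeds i r') {i : Fin n} (hi : i ∉ F) :
    E.Reaches i r := by
  obtain ⟨m, hm⟩ := r
  induction m generalizing i with
  | zero => exact E.reaches_zero hn hF hin hi
  | succ m ih =>
    have hreach : ∀ i ∉ F, E.Reaches i ⟨m, by omega⟩ := fun i hi =>
      ih hi (by omega) (fun r' hr' => h r' (hr'.trans (Fin.mk_lt_mk.2 m.lt_succ_self)))
    obtain ⟨l, -, hs⟩ := E.round_dichotomy hn hF hreach
    exact (hs.resolve_left (h _ (Fin.mk_lt_mk.2 m.lt_succ_self))).2 i hi |>.2 hm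

/-- Reaching a round requires having passed all earlier ones, which success in one of them excludes.
-/
theorem not_reaches_of_succeeds (hn : 3 * t + 1 ≤ n) {i r r' : Fin n} (hi : i ∉ F)
    (h : E.Succeeds i r) (hr : r < r') : ¬ E.Reaches i r' := by
  rintro ⟨k, hk⟩
  exact h.2 k (((E.inv hn hi k).2.2.coinOn r' hk).2 r hr)

/-- A round whose leader has a completed dispersal succeeds. -/
theorem Good.succeeds (hn : 3 * t + 1 ≤ n) (hF : F.card ≤ t) (hin : E.CommonInputs)
    {l : Fin n} (hl : E.Good l) {i r : Fin n} (hi : i ∉ F) (he : E.Elects i r l) :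
    ∀ p ∉ F, E.Succeeds p r := by
  obtain ⟨k, hk⟩ := he
  have hon : E.Reaches i r := ⟨k, (E.inv hn hi k).2.2.coinOut r l hk⟩
  -- Node `i` has reached round `r`, so no earlier round succeeded for all honest nodes. By the
  -- dichotomy they then all arrive here.
  have hreach : ∀ p ∉ F, E.Reaches p r := fun p hp =>
    E.reaches_of_not_succeeds hn hF hin
      (fun r' hr' hs => E.not_reaches_of_succeeds hn hi (hs i hi) hr' hon) hp
  obtain ⟨l', hl', hs⟩ := E.round_dichotomy hn hF hreach
  obtain rfl := (E.coin r).consistency i hi i hi l l' ⟨k, hk⟩ (hl' i hi)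
  exact hs.resolve_right fun h => h.1 hl

end Execution

end APVA

/-! ### The termination theorem -/

theorem mainTheorem5 (n t : ℕ) (hn : 3 * t + 1 ≤ n) (F : Finset (Fin n)) (hF : F.card ≤ t)
    (E : APVA.Execution n t F) (hin : E.CommonInputs) :
    -- with pairwise distinct leaders in the `n` rounds, every honest node terminates
    (E.DistinctLeaders → ∀ i ∉ F, E.Terminates i) ∧
    -- whatever the coins are:
    ∃ I : Finset (Fin n), E.Completed I ∧ n - 2 * t ≤ I.card ∧
      -- a round whose leader lies in `I` succeeds, and is the last one
      (∀ r, ∀ l ∈ I, (∃ i ∉ F, E.Elects i r l) →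
        ∀ i ∉ F, E.Terminates i ∧ ∀ r' > r, ¬ E.Reaches i r') ∧
      -- the only way not to terminate is that all `n` rounds elect leaders outside `I`
      ((∀ i ∉ F, E.Terminates i) ∨ ∀ r, ∃ l ∉ I, ∀ i ∉ F, E.Elects i r l) := by
  obtain ⟨I, hI, hcard⟩ := E.exists_completed hn hF hin
  have hgood : ∀ l ∈ I, E.Good l := fun l hl =>
    ⟨hI.1 l hl, hI.2.choose, hI.2.choose_spec.1 l hl⟩
  have hsucc : ∀ r, ∀ l ∈ I, (∃ i ∉ F, E.Elects i r l) → ∀ i ∉ F, E.Succeeds i r :=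
    fun r l hl ⟨i, hi, he⟩ => (hgood l hl).succeeds E hn hF hin hi he
  have halt : (∀ i ∉ F, E.Terminates i) ∨ ∀ r, ∃ l ∉ I, ∀ i ∉ F, E.Elects i r l := by
    by_cases hT : ∀ i ∉ F, E.Terminates i
    · exact .inl hT
    · have hno : ∀ r, ¬ ∀ i ∉ F, E.Succeeds i r := fun r hs => hT fun i hi => (hs i hi).1
      refine .inr fun r => ?_
      obtain ⟨l, hl⟩ := E.exists_elects hn hF fun i hi =>
        E.reaches_of_not_succeeds hn hF hin (fun r' _ => hno r') hi (r := r)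
      obtain ⟨i, hi⟩ := APVA.Execution.exists_honest (F := F) hn hF
      exact ⟨l, fun hlI => hno r (hsucc r l hlI ⟨i, hi, hl i hi⟩), hl⟩
  refine ⟨fun hd => ?_, I, hI, hcard, fun r l hl he i hi => ?_, halt⟩
  · refine halt.resolve_right fun h => ?_
    choose f hf he using h
    obtain ⟨i, hi⟩ := APVA.Execution.exists_honest (F := F) hn hF
    -- There are as many rounds as nodes, so distinct leaders make the map from rounds to leaders
    -- surjective. It then meets `I`, which is nonempty because `n - 2 * t > 0`.
    have hinj : Function.Injective f := fun r r' e =>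
      hd i hi i hi r r' (f r) (he r i hi) (e ▸ he r' i hi)
    obtain ⟨l, hl⟩ := Finset.card_pos.1 (show 0 < I.card by omega)
    obtain ⟨r, rfl⟩ := Finite.surjective_of_injective hinj l
    exact hf r hl
  · have hs := hsucc r l hl he i hi
    exact ⟨hs.1, fun r' hr' => E.not_reaches_of_succeeds hn hi hs hr'⟩
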